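/- All graphs are finite, simple and undirected. A *matching* of a graph $H=(V,E)$ is a set $M \subseteq E$ of edges no two distinct ones of which share a vertex. For a graph family (a set of graphs) $\mathcal F$, let $\#\mathrm{Match}(\mathcal F)$ be the problem: given a graph $H \in \mathcal F$, compute the number of matchings of $H$. Let $\mathrm{PrMatching}(\mathcal F)$ be the problem: given a graph $G=(V,E) \in \mathcal F$ and rational probabilities $\pi : E \to [0,1] \cap \mathbb Q$ (written in binary), compute the rational number $$\Pr\nolimits_{\text{matching}}(G,\pi) = \sum_{M \text{ matching of } G} \ \prod_{e \in M} \pi(e) \prod_{e \in E \setminus M} (1-\pi(e)).$$ Let $\mathrm{sub}(H,6)$ denote the graph obtained from $H$ by replacing every edge $\{x,y\}$ by a path of length $6$ from $x$ to $y$ whose five intermediate vertices are fresh; it is determined up to the naming of its vertices, and families of such graphs are taken up to this naming. **Proposition.** For every graph family $\mathcal F$, the problem $\#\mathrm{Match}(\mathcal F)$ reduces in polynomial time (by a deterministic polynomial-time Turing reduction) to $\mathrm{PrMatching}(\mathcal G)$, where $\mathcal G = \{\mathrm{sub}(H,6) \mid H \in \mathcal F\}$. That is, there is a deterministic algorithm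 with access to an oracle such that, for every oracle that answers all instances of $\mathrm{PrMatching}(\mathcal G)$ correctly, the algorithm on every input $H \in \mathcal F$ outputs the number of matchings of $H$, in time polynomial in the size of the encoding of $H$. -/

import Mathlib

namespace MatchingReduction

/-! ## Machine model

Data are finite binary trees (S-expressions).  A program is an expression of a small while-language
over trees, with access to an oracle.  Evaluating any construct on a tree `x` is charged the full
size of `x` (trees are never shared), in addition to the cost of all sub-evaluations; an oracle call
is charged the size of the query plus the size of the answer.  Up to a polynomial this is the running
time of a multitape oracle Turing machine working on the written-out trees. -/

/-- Binary trees, the data manipulated by programs. -/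
inductive Data : Type
  | nil : Data
  | cons : Data → Data → Data

/-- The number of nodes of a tree, leaves included. -/
def Data.size : Data → ℕ
  | .nil => 1
  | .cons a b => a.size + b.size + 1

/-- The left subtree (`nil` for the empty tree). -/
def Data.head : Data → Data
  | .nil => .nil
  | .cons a _ => a

/-- The right subtree (`nil` for the empty tree). -/
def Data.tail : Data → Data
  | .nil => .nil
  | .cons _ b => b

/-- Programs with an oracle.  Each program maps a tree to a tree (if it terminates). -/
inductive Prog : Type
  /-- return the argument -/
  | id : Prog
  /-- return the empty tree -/
  | nil : Prog
  /-- return the left subtree of the argument -/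
  | head : Prog
  /-- return the right subtree of the argument -/
  | tail : Prog
  /-- run both programs on the argument and join their results -/
  | pair : Prog → Prog → Prog
  /-- run the first program, then the second one on its result -/
  | seq : Prog → Prog → Prog
  /-- if the result of the first program is nonempty run the second program, else the third -/
  | cond : Prog → Prog → Prog → Prog
  /-- while the result of the first program is nonempty, replace the argument by the result of the
  second program -/
  | while : Prog → Prog → Prog
  /-- query the oracle on the argument -/
  | oracle : Prog

/-- `Eval O P x y t`: with oracle `O`, program `P` halts on argument `x` with result `y` after time
`t`. -/
inductive Eval (O : Data → Data) : Prog → Data → Data → ℕ → Prop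
  | id (x : Data) : Eval O .id x x x.size
  | nil (x : Data) : Eval O .nil x .nil x.size
  | head (x : Data) : Eval O .head x x.head x.size
  | tail (x : Data) : Eval O .tail x x.tail x.size
  | pair {P Q : Prog} {x a b : Data} {s t : ℕ} :
      Eval O P x a s → Eval O Q x b t → Eval O (.pair P Q) x (.cons a b) (x.size + s + t)
  | seq {P Q : Prog} {x y z : Data} {s t : ℕ} :
      Eval O P x y s → Eval O Q y z t → Eval O (.seq P Q) x z (x.size + s + t)
  | cond_true {C P Q : Prog} {x a b y : Data} {s t : ℕ} :
      Eval O C x (.cons a b) s → Eval O P x y t → Eval O (.cond C P Q) x y (x.size + s + t)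
  | cond_false {C P Q : Prog} {x y : Data} {s t : ℕ} :
      Eval O C x .nil s → Eval O Q x y t → Eval O (.cond C P Q) x y (x.size + s + t)
  | while_stop {C P : Prog} {x : Data} {s : ℕ} :
      Eval O C x .nil s → Eval O (.while C P) x x (x.size + s)
  | while_step {C P : Prog} {x a b y z : Data} {s t u : ℕ} :
      Eval O C x (.cons a b) s → Eval O P x y t → Eval O (.while C P) y z u →
        Eval O (.while C P) x z (x.size + s + t + u)
  | oracle (x : Data) : Eval O .oracle x (O x) (x.size + (O x).size)

/-! ## Computational problems and polynomial-time Turing reductions -/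

/-- A function problem: instances, their encoding as data, and the encoded correct output.
Data that do not encode an instance are not valid inputs. -/
structure Problem where
  /-- the instances -/
  Inst : Type
  /-- the encoding of an instance -/
  input : Inst → Data
  /-- different instances have different encodings -/
  input_injective : Function.Injective input
  /-- the encoding of the correct output -/
  output : Inst → Data

/-- `O` answers all instances of `Q` correctly (with arbitrary answers on other data). -/
def Problem.Solves (Q : Problem) (O : Data → Data) : Prop :=
  ∀ i : Q.Inst, O (Q.input i) = Q.output i

/-- Polynomial-time Turing reducibility of `P` to `Q`: a single program which, given any oracle
solving `Q`, outputs the solution of each instance of `P`, in time polynomial in the size of the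
encoding of the instance. -/
def PolyTimeReduces (P Q : Problem) : Prop :=
  ∃ (M : Prog) (p : Polynomial ℕ), ∀ O : Data → Data, Q.Solves O → ∀ i : P.Inst,
    ∃ t : ℕ, Eval O M (P.input i) (P.output i) t ∧ t ≤ p.eval (P.input i).size

/-! ## Encodings of numbers and lists -/

/-- A bit. -/
def encBool : Bool → Data
  | false => .nil
  | true => .cons .nil .nil

/-- A list, given an encoding of its elements. -/
def encList {α : Type} (f : α → Data) : List α → Data
  | [] => .nil
  | a :: l => .cons (f a) (encList f l)

/-- An optional value, given an encoding of values. -/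
def encOption {α : Type} (f : α → Data) : Option α → Data
  | none => .nil
  | some a => .cons .nil (f a)

/-- A natural number in binary, least significant bit first. -/
def encNat (n : ℕ) : Data := encList encBool n.bits

/-- An integer, by its sign bit (`true` for negative numbers) and its absolute value. -/
def encInt (z : ℤ) : Data := .cons (encBool (decide (z < 0))) (encNat z.natAbs)

/-- A rational number, by its reduced numerator and denominator, both in binary. -/
def encRat (q : ℚ) : Data := .cons (encInt q.num) (encNat q.den)

/-- A square matrix, as the list of its rows, given an encoding of entries. -/
def encMatrix {α : Type} (f : α → Data) {n : ℕ} (A : Fin n → Fin n → α) : Data :=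
  encList (encList f) (List.ofFn fun i => List.ofFn (A i))

theorem encBool_injective : Function.Injective encBool := by
  intro a b h
  cases a <;> cases b <;> simp_all [encBool]

theorem encList_injective {α : Type} {f : α → Data} (hf : Function.Injective f) :
    Function.Injective (encList f) := by
  intro l
  induction l with
  | nil => intro l' h; cases l' <;> simp_all [encList]
  | cons a l ih =>
    intro l' h
    cases l' with
    | nil => simp [encList] at h
    | cons b l' =>
      simp only [encList, Data.cons.injEq] at h
      rw [hf h.1, ih h.2]

theorem encOption_injective {α : Type} {f : α → Data} (hf : Function.Injective f) :
    Function.Injective (encOption f) := by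
  intro a b h
  cases a <;> cases b <;> simp_all [encOption]
  exact hf h

theorem encNat_injective : Function.Injective encNat := by
  intro a b h
  have h' := encList_injective encBool_injective h
  apply (Nat.digits_inj_iff (b := 2)).1
  rw [Nat.digits_two_eq_bits, Nat.digits_two_eq_bits, h']

theorem encInt_injective : Function.Injective encInt := by
  intro a b h
  simp only [encInt, Data.cons.injEq] at h
  have h1 := encBool_injective h.1
  have h2 := encNat_injective h.2
  simp only [decide_eq_decide] at h1
  omega

theorem encRat_injective : Function.Injective encRat := by
  intro a b h
  simp only [encRat, Data.cons.injEq] at h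
  exact Rat.ext (encInt_injective h.1) (encNat_injective h.2)

theorem encMatrix_size_eq {α : Type} {f : α → Data} (hf : Function.Injective f) {n m : ℕ}
    {A : Fin n → Fin n → α} {B : Fin m → Fin m → α} (h : encMatrix f A = encMatrix f B) :
    n = m := by
  have h' := congrArg List.length (encList_injective (encList_injective hf) h)
  simpa using h'

theorem encMatrix_injective {α : Type} {f : α → Data} (hf : Function.Injective f) {n : ℕ} :
    Function.Injective (encMatrix f (n := n)) := by
  intro A B h
  have h' := List.ofFn_injective (encList_injective (encList_injective hf) h)
  funext i
  exact List.ofFn_injective (congrFun h' i)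

/-! ## Graphs, matchings and probabilistic graphs -/

/-- A set of edges is a matching if distinct edges of it share no vertex. -/
def IsMatching {V : Type} {G : SimpleGraph V} (M : Finset G.edgeSet) : Prop :=
  ∀ e ∈ M, ∀ e' ∈ M, e ≠ e' → ∀ v : V, ¬ (v ∈ (e : Sym2 V) ∧ v ∈ (e' : Sym2 V))

open Classical in
/-- The set of all matchings of a finite graph. -/
noncomputable def matchings {V : Type} [Fintype V] (G : SimpleGraph V) :
    Finset (Finset G.edgeSet) :=
  Finset.univ.filter fun M => IsMatching M

open Classical in
/-- The probability of the edge set `S` when every edge `e` is drawn independently with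
probability `π e`. -/
noncomputable def edgeSetProb {V : Type} [Fintype V] {G : SimpleGraph V} (π : G.edgeSet → ℚ)
    (S : Finset G.edgeSet) : ℚ :=
  (∏ e ∈ S, π e) * ∏ e ∈ Sᶜ, (1 - π e)

/-- The probability of drawing a matching. -/
noncomputable def matchingProb {V : Type} [Fintype V] {G : SimpleGraph V} (π : G.edgeSet → ℚ) : ℚ :=
  ∑ M ∈ matchings G, edgeSetProb π M

/-- A finite simple graph as input of an algorithm: the vertices are numbered `0, …, n - 1`. -/
@[ext]
structure FinGraph where
  /-- the number of vertices -/
  n : ℕ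
  /-- the graph -/
  graph : SimpleGraph (Fin n)

/-- A finite graph with rational edge probabilities. -/
structure ProbGraph extends FinGraph where
  /-- the probability of each edge -/
  prob : graph.edgeSet → ℚ
  prob_nonneg : ∀ e, 0 ≤ prob e
  prob_le_one : ∀ e, prob e ≤ 1

open Classical in
/-- The encoding of a graph is its adjacency matrix. -/
noncomputable def encGraph (G : FinGraph) : Data :=
  encMatrix encBool fun i j => decide (G.graph.Adj i j)

open Classical in
/-- The entries of the weighted adjacency matrix: the probability of the edge `{i, j}`, or `none` if
there is no such edge. -/
noncomputable def ProbGraph.entry (P : ProbGraph) (i j : Fin P.n) : Option ℚ :=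
  if h : P.graph.Adj i j then some (P.prob ⟨s(i, j), h⟩) else none

/-- The encoding of a probabilistic graph is its weighted adjacency matrix. -/
noncomputable def encProbGraph (P : ProbGraph) : Data :=
  encMatrix (encOption encRat) P.entry

theorem encGraph_injective : Function.Injective encGraph := by
  rintro ⟨n, G⟩ ⟨m, H⟩ h
  obtain rfl : n = m := encMatrix_size_eq encBool_injective h
  have h' := encMatrix_injective encBool_injective h
  congr 1
  ext i j
  simpa using congrFun (congrFun h' i) j

theorem encProbGraph_injective : Function.Injective encProbGraph := by
  rintro ⟨⟨n, G⟩, p, hp0, hp1⟩ ⟨⟨m, H⟩, q, hq0, hq1⟩ h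
  obtain rfl : n = m := encMatrix_size_eq (encOption_injective encRat_injective) h
  have h' := encMatrix_injective (encOption_injective encRat_injective) h
  have hij : ∀ i j, _ = _ := fun i j => congrFun (congrFun h' i) j
  simp only [ProbGraph.entry] at hij
  obtain rfl : G = H := by
    ext i j
    have := hij i j
    by_cases h1 : G.Adj i j <;> by_cases h2 : H.Adj i j <;> simp_all
  congr 1
  funext ⟨e, he⟩
  induction e using Sym2.ind with
  | _ i j =>
    have h1 : G.Adj i j := he
    have := hij i j
    simpa [h1] using this

/-! ## Subdivisions -/

section Subdivision

variable {V : Type} [LinearOrder V]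

/-- The vertices of the `η`-subdivision of `H`: those of `H` and, for every edge `e`, `η e - 1`
fresh ones. -/
abbrev SubVertex (H : SimpleGraph V) (η : H.edgeSet → ℕ+) : Type :=
  V ⊕ (Σ e : H.edgeSet, Fin ((η e : ℕ) - 1))

/-- The `k`-th vertex (`0 ≤ k ≤ η e`) on the path that replaces the edge `e = {x, y}`, where `x < y`:
it is `x` for `k = 0`, `y` for `k = η e`, and fresh in between. -/
def pathVertex (H : SimpleGraph V) (η : H.edgeSet → ℕ+) (e : H.edgeSet) (k : ℕ) :
    SubVertex H η :=
  if k = 0 then Sum.inl (e : Sym2 V).inf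
  else if h : k - 1 < (η e : ℕ) - 1 then Sum.inr ⟨e, ⟨k - 1, h⟩⟩
  else Sum.inl (e : Sym2 V).sup

/-- The `η`-subdivision of `H`: every edge `e` is replaced by a path of length `η e`. -/
def subdivision (H : SimpleGraph V) (η : H.edgeSet → ℕ+) : SimpleGraph (SubVertex H η) :=
  SimpleGraph.fromEdgeSet
    {s(pathVertex H η e k, pathVertex H η e (k + 1)) | (e : H.edgeSet) (k : ℕ) (_ : k < η e)}

end Subdivision

/-- The family of the `k`-subdivisions of the graphs of `F`, with arbitrary numbering of the
vertices. -/
def subdivisionFamily (F : Set FinGraph) (k : ℕ+) : Set FinGraph :=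
  {G | ∃ H ∈ F, Nonempty (G.graph ≃g subdivision H.graph fun _ => k)}

/-! ## The two problems -/

/-- Counting the matchings of the graphs of a family. -/
noncomputable def countMatchings (F : Set FinGraph) : Problem where
  Inst := {G : FinGraph // G ∈ F}
  input G := encGraph G.1
  input_injective _ _ h := Subtype.ext (encGraph_injective h)
  output G := encNat (matchings G.1.graph).card

/-- Computing the probability of a matching under rational edge probabilities, on the graphs of a
family. -/
noncomputable def prMatching (F : Set FinGraph) : Problem where
  Inst := {P : ProbGraph // P.toFinGraph ∈ F}
  input P := encProbGraph P.1
  input_injective _ _ h := Subtype.ext (encProbGraph_injective h)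
  output P := encRat (matchingProb P.1.prob)

end MatchingReduction

/-!
The number of matchings of a graph `H` with `m` edges is computed by a single query. Give the six
edges of the path that replaces an edge `{x, y}` probabilities `p₀, …, p₅`, in the order from the
smaller to the larger end. A matching of the subdivision is a choice of a matching of each path
such that at every vertex of `H` at most one of the adjacent path edges is chosen. Let `W s t` be
the total weight of the matchings of one path which contain the edge at `x` iff `s` and the edge at
`y` iff `t`. The probability of a matching is then the sum, over all choices of values `(s, t)` for
the paths that do not conflict at a vertex, of the product of the values `W s t`. If
`W true false = W false true = 0` and `W false false = W true true = κ`, each path behaves like the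
edge it replaces, and the sum is `κ ^ m` times the number of matchings of `H`
(`sum_matchings_subdivision`, `sum_endsIndep_eq`).

No probabilities in `[0, 1]` have this property with `κ ≠ 0`, but the numbers
`-1, 3/4, 2, -1, 3, 4/3` do, with `κ = 2`. They are realised modulo an integer: with
`T = 2 ^ (m + 3)`, the probabilities `3/T, 3/4, 18/T², 3/T, 27/T², 12/T²` lie in `[0, 1]` and are
congruent to these numbers modulo `T + 3` (`gadgetWeight_path`). So if the oracle answers
`a / 2 ^ s`, then `a` is congruent to `2 ^ (s + m)` times the number of matchings modulo the odd
number `T + 3` (`matchingProb_subdivision`). As there are at most `2 ^ m < T + 3` matchings, their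
number is found by dividing `a` by two, `s + m` times, modulo `T + 3` (`decodeAnswer_eq`).

`PolyTime f` says that some program computes `f` in polynomial time on encodings, for every oracle.
This class is closed under composition, case distinction and, by the only loop that is written out,
folding a list with an accumulator of polynomially bounded size (`PolyTime.foldl_of_bound`). Hence
the two phases, the construction of the query (`PolyTime.queryMatrix`, `encProbGraph_query`) and the
decoding of the answer (`PolyTime.decodeAnswer`), are treated as ordinary functions on lists, and
their running time follows the shape of their definitions.
-/

namespace MatchingReduction

/-! ### Polynomial-time functions -/

/-- A fixed encoding of the elements of a type as trees. -/
class Enc (α : Type) where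
  /-- the encoding -/
  enc : α → Data

open Enc (enc)

instance : Enc Bool := ⟨encBool⟩

instance {α : Type} [Enc α] : Enc (List α) := ⟨encList enc⟩

instance {α : Type} [Enc α] : Enc (Option α) := ⟨encOption enc⟩

instance {α β : Type} [Enc α] [Enc β] : Enc (α × β) := ⟨fun x => .cons (enc x.1) (enc x.2)⟩

/-- The unary encoding of a natural number. -/
def encUnary : ℕ → Data
  | 0 => .nil
  | n + 1 => .cons .nil (encUnary n)

/-- Natural numbers are encoded in unary; numbers in binary are lists of bits. -/
instance : Enc ℕ := ⟨encUnary⟩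

/-- The size of the encoding of an element. -/
def sz {α : Type} [Enc α] (a : α) : ℕ := (enc a).size

/-- With oracle `O`, program `P` maps `x` to `y` in time at most `t`. -/
def RunsIn (O : Data → Data) (P : Prog) (x y : Data) (t : ℕ) : Prop :=
  ∃ t' ≤ t, Eval O P x y t'

/-- The function `f` is computed, on encodings, by a program in polynomial time, whatever the
oracle. -/
def PolyTime {α β : Type} [Enc α] [Enc β] (f : α → β) : Prop :=
  ∃ (P : Prog) (p : Polynomial ℕ), ∀ (O : Data → Data) (a : α),
    RunsIn O P (enc a) (enc (f a)) (p.eval (sz a))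

theorem polynomial_eval_mono (p : Polynomial ℕ) {a b : ℕ} (h : a ≤ b) : p.eval a ≤ p.eval b := by
  rw [Polynomial.eval_eq_sum, Polynomial.eval_eq_sum]
  exact Finset.sum_le_sum fun i _ => Nat.mul_le_mul_left _ (Nat.pow_le_pow_left h i)

theorem Data.one_le_size (x : Data) : 1 ≤ x.size := by
  cases x <;> simp [Data.size]

theorem Data.size_head_le (x : Data) : x.head.size ≤ x.size := by
  cases x <;> simp [Data.size, Data.head]; omega

theorem Data.size_tail_le (x : Data) : x.tail.size ≤ x.size := by
  cases x <;> simp [Data.size, Data.tail]; omega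

/-- A program has to spend time on writing its output. -/
theorem Eval.size_le {O : Data → Data} {P : Prog} {x y : Data} {t : ℕ} (h : Eval O P x y t) :
    y.size ≤ t := by
  induction h with
  | id x => exact le_rfl
  | nil x => exact x.one_le_size
  | head x => exact x.size_head_le
  | tail x => exact x.size_tail_le
  | @pair P Q x => have := x.one_le_size; simp only [Data.size]; omega
  | while_stop => omega
  | oracle x => omega
  | _ => omega

namespace RunsIn

variable {O : Data → Data} {P Q C : Prog} {x y z a b : Data} {s t u : ℕ}

theorem mono (h : RunsIn O P x y s) (hst : s ≤ t) : RunsIn O P x y t := by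
  obtain ⟨t', ht', h⟩ := h
  exact ⟨t', ht'.trans hst, h⟩

theorem size_le (h : RunsIn O P x y t) : y.size ≤ t := by
  obtain ⟨t', ht', h⟩ := h
  exact h.size_le.trans ht'

protected theorem id : RunsIn O .id x x x.size := ⟨_, le_rfl, .id x⟩

protected theorem nil : RunsIn O .nil x .nil x.size := ⟨_, le_rfl, .nil x⟩

protected theorem head : RunsIn O .head x x.head x.size := ⟨_, le_rfl, .head x⟩

protected theorem tail : RunsIn O .tail x x.tail x.size := ⟨_, le_rfl, .tail x⟩

theorem pair (h₁ : RunsIn O P x a s) (h₂ : RunsIn O Q x b t) :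
    RunsIn O (.pair P Q) x (.cons a b) (x.size + s + t) := by
  obtain ⟨s', hs, h₁⟩ := h₁
  obtain ⟨t', ht, h₂⟩ := h₂
  exact ⟨_, by omega, .pair h₁ h₂⟩

theorem seq (h₁ : RunsIn O P x y s) (h₂ : RunsIn O Q y z t) :
    RunsIn O (.seq P Q) x z (x.size + s + t) := by
  obtain ⟨s', hs, h₁⟩ := h₁
  obtain ⟨t', ht, h₂⟩ := h₂
  exact ⟨_, by omega, .seq h₁ h₂⟩

theorem cond_true (h₁ : RunsIn O C x (.cons a b) s) (h₂ : RunsIn O P x y t) :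
    RunsIn O (.cond C P Q) x y (x.size + s + t) := by
  obtain ⟨s', hs, h₁⟩ := h₁
  obtain ⟨t', ht, h₂⟩ := h₂
  exact ⟨_, by omega, .cond_true h₁ h₂⟩

theorem cond_false (h₁ : RunsIn O C x .nil s) (h₂ : RunsIn O Q x y t) :
    RunsIn O (.cond C P Q) x y (x.size + s + t) := by
  obtain ⟨s', hs, h₁⟩ := h₁
  obtain ⟨t', ht, h₂⟩ := h₂
  exact ⟨_, by omega, .cond_false h₁ h₂⟩

theorem while_of_nil (h₁ : RunsIn O C x .nil s) : RunsIn O (.while C P) x x (x.size + s) := by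
  obtain ⟨s', hs, h₁⟩ := h₁
  exact ⟨_, by omega, Eval.while_stop h₁⟩

theorem while_step (h₁ : RunsIn O C x (.cons a b) s) (h₂ : RunsIn O P x y t)
    (h₃ : RunsIn O (.while C P) y z u) : RunsIn O (.while C P) x z (x.size + s + t + u) := by
  obtain ⟨s', hs, h₁⟩ := h₁
  obtain ⟨t', ht, h₂⟩ := h₂
  obtain ⟨u', hu, h₃⟩ := h₃
  exact ⟨_, by omega, .while_step h₁ h₂ h₃⟩

end RunsIn

variable {α β γ δ σ : Type} [Enc α] [Enc β] [Enc γ] [Enc δ] [Enc σ]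

theorem one_le_sz (a : α) : 1 ≤ sz a := Data.one_le_size _

@[simp] theorem sz_prod (x : α × β) : sz x = sz x.1 + sz x.2 + 1 := rfl

@[simp] theorem sz_nil : sz ([] : List α) = 1 := rfl

@[simp] theorem sz_cons (a : α) (l : List α) : sz (a :: l) = sz a + sz l + 1 := rfl

theorem sz_append (l l' : List α) : sz (l ++ l') ≤ sz l + sz l' := by
  induction l with
  | nil => simp
  | cons a l ih => simp only [List.cons_append, sz_cons]; omega

theorem length_le_sz (l : List α) : l.length ≤ sz l := by
  induction l with
  | nil => simp
  | cons a l ih => simp only [List.length_cons, sz_cons]; omega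

theorem sz_le_of_mem {a : α} {l : List α} (h : a ∈ l) : sz a ≤ sz l := by
  induction l with
  | nil => simp at h
  | cons b l ih =>
    rcases List.mem_cons.1 h with rfl | h
    · simp only [sz_cons]; omega
    · have := ih h; simp only [sz_cons]; omega

@[simp] theorem sz_some (a : α) : sz (some a) = sz a + 2 := by
  change 1 + (enc a).size + 1 = (enc a).size + 2
  omega

@[simp] theorem sz_succ (n : ℕ) : sz (n + 1) = sz n + 2 := by
  change 1 + (encUnary n).size + 1 = (encUnary n).size + 2
  omega

theorem sz_bool_le (b : Bool) : sz b ≤ 3 := by cases b <;> simp [sz, enc, encBool, Data.size]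

theorem sz_bits_le (l : List Bool) : sz l ≤ 4 * l.length + 1 := by
  induction l with
  | nil => simp
  | cons b l ih => have := sz_bool_le b; simp only [sz_cons, List.length_cons]; omega

namespace PolyTime

theorem exists_size_le {f : α → β} (hf : PolyTime f) :
    ∃ p : Polynomial ℕ, ∀ a, sz (f a) ≤ p.eval (sz a) := by
  obtain ⟨P, p, h⟩ := hf
  exact ⟨p, fun a => (h id a).size_le⟩

theorem of_linear {f : α → β} (P : Prog)
    (h : ∀ (O : Data → Data) (a : α), RunsIn O P (enc a) (enc (f a)) (4 * (enc a).size)) :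
    PolyTime f :=
  ⟨P, 4 * .X, fun O a => (h O a).mono (by simp [sz])⟩

protected theorem id : PolyTime (fun a : α => a) :=
  of_linear .id fun O a => RunsIn.id.mono (by omega)

theorem comp {g : β → γ} {f : α → β} (hg : PolyTime g) (hf : PolyTime f) :
    PolyTime fun a => g (f a) := by
  obtain ⟨Q, q, hg⟩ := hg
  obtain ⟨P, p, hf⟩ := hf
  refine ⟨.seq P Q, .X + p + q.comp p, fun O a => ?_⟩
  refine ((hf O a).seq (hg O (f a))).mono ?_
  have := polynomial_eval_mono q (hf O a).size_le
  simp only [Polynomial.eval_add, Polynomial.eval_X, Polynomial.eval_comp]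
  exact Nat.add_le_add le_rfl this

theorem pair {f : α → β} {g : α → γ} (hf : PolyTime f) (hg : PolyTime g) :
    PolyTime fun a => (f a, g a) := by
  obtain ⟨P, p, hf⟩ := hf
  obtain ⟨Q, q, hg⟩ := hg
  refine ⟨.pair P Q, .X + p + q, fun O a => ?_⟩
  exact ((hf O a).pair (hg O a)).mono (by simp [sz])

theorem fst {f : α → β × γ} (hf : PolyTime f) : PolyTime fun a => (f a).1 :=
  comp (g := Prod.fst)
    (of_linear .head fun O a => RunsIn.head.mono (Nat.le_mul_of_pos_left _ (by omega))) hf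

theorem snd {f : α → β × γ} (hf : PolyTime f) : PolyTime fun a => (f a).2 :=
  comp (g := Prod.snd)
    (of_linear .tail fun O a => RunsIn.tail.mono (Nat.le_mul_of_pos_left _ (by omega))) hf

theorem const (b : β) : PolyTime fun _ : α => b := by
  suffices ∀ d : Data, ∃ (P : Prog) (p : Polynomial ℕ), ∀ (O : Data → Data) (x : Data),
      RunsIn O P x d (p.eval x.size) by
    obtain ⟨P, p, h⟩ := this (enc b)
    exact ⟨P, p, fun O a => h O (enc a)⟩
  intro d
  induction d with
  | nil => exact ⟨.nil, .X, fun O x => by simpa using RunsIn.nil⟩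
  | cons a b iha ihb =>
    obtain ⟨P, p, hP⟩ := iha
    obtain ⟨Q, q, hQ⟩ := ihb
    exact ⟨.pair P Q, .X + p + q, fun O x => ((hP O x).pair (hQ O x)).mono (by simp)⟩

theorem ite {c : α → Bool} {f g : α → β} (hc : PolyTime c) (hf : PolyTime f) (hg : PolyTime g) :
    PolyTime fun a => if c a then f a else g a := by
  obtain ⟨C, r, hc⟩ := hc
  obtain ⟨P, p, hf⟩ := hf
  obtain ⟨Q, q, hg⟩ := hg
  refine ⟨.cond C P Q, .X + r + p + q, fun O a => ?_⟩
  have h := hc O a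
  simp only [Polynomial.eval_add, Polynomial.eval_X]
  by_cases hca : c a
  · rw [hca] at h
    rw [if_pos hca]
    exact (RunsIn.cond_true h (hf O a)).mono (by simp only [sz]; omega)
  · rw [Bool.eq_false_of_not_eq_true hca] at h
    rw [if_neg hca]
    exact (RunsIn.cond_false h (hg O a)).mono (by simp only [sz]; omega)

/-- Case distinction on an optional value. -/
theorem optionElim {o : α → Option β} {f : α → γ} {g : α → β → γ} (ho : PolyTime o)
    (hf : PolyTime f) (hg : PolyTime fun p : α × β => g p.1 p.2) :
    PolyTime fun a => (o a).elim (f a) (g a) := by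
  obtain ⟨C, r, ho⟩ := ho
  obtain ⟨P, p, hf⟩ := hf
  obtain ⟨Q, q, hg⟩ := hg
  refine ⟨.cond C (.seq (.pair .id (.seq C .tail)) Q) P,
    8 * .X + 8 * r + p + q.comp (.X + r + 1), fun O a => ?_⟩
  have h := ho O a
  have hs := h.size_le
  simp only [Polynomial.eval_add, Polynomial.eval_X, Polynomial.eval_mul, Polynomial.eval_ofNat,
    Polynomial.eval_comp, Polynomial.eval_one]
  rcases hoa : o a with _ | b
  · rw [hoa] at h
    exact (RunsIn.cond_false h (hf O a)).mono (by simp only [sz]; omega)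
  · rw [hoa] at h hs
    have h1 : RunsIn O _ (enc a) (.cons (enc a) (enc b)) _ :=
      RunsIn.id.pair (h.seq RunsIn.tail)
    have h2 := RunsIn.cond_true (Q := P) h (h1.seq (hg O (a, b)))
    refine h2.mono ?_
    have h3 : q.eval (sz (a, b)) ≤ q.eval (sz a + r.eval (sz a) + 1) := by
      apply polynomial_eval_mono
      have : (enc (some b)).size = sz b + 2 := sz_some b
      simp only [sz_prod]; omega
    simp only [sz] at *
    omega

theorem some {f : α → β} (hf : PolyTime f) : PolyTime fun a => Option.some (f a) := by
  obtain ⟨P, p, hf⟩ := hf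
  refine ⟨.pair .nil P, .X + .X + p, fun O a => ?_⟩
  exact (RunsIn.nil.pair (hf O a)).mono (by simp [sz])

theorem cons {f : α → β} {g : α → List β} (hf : PolyTime f) (hg : PolyTime g) :
    PolyTime fun a => f a :: g a := by
  obtain ⟨P, p, h⟩ := hf.pair hg
  exact ⟨P, p, h⟩

theorem tail {f : α → List β} (hf : PolyTime f) : PolyTime fun a => (f a).tail := by
  refine comp (g := List.tail) (of_linear .tail fun O l => ?_) hf
  cases l <;> exact RunsIn.tail.mono (Nat.le_mul_of_pos_left _ (by omega))

theorem headD_false {f : α → List Bool} (hf : PolyTime f) :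
    PolyTime fun a => (f a).headD false := by
  refine comp (g := fun l : List Bool => l.headD false) (of_linear .head fun O l => ?_) hf
  cases l <;> exact RunsIn.head.mono (Nat.le_mul_of_pos_left _ (by omega))

theorem head? {f : α → List β} (hf : PolyTime f) : PolyTime fun a => (f a).head? := by
  refine comp (g := List.head?) ⟨.cond .id (.pair .nil .head) .nil, 8 * .X, fun O l => ?_⟩ hf
  rw [show (8 * Polynomial.X : Polynomial ℕ).eval (sz l) = 8 * (enc l).size by simp [sz]]
  rcases l with _ | ⟨a, l⟩
  · have h : RunsIn O .id (enc ([] : List β)) .nil (enc ([] : List β)).size := RunsIn.id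
    exact (h.cond_false RunsIn.nil).mono (by omega)
  · have h : RunsIn O .id (enc (a :: l)) (.cons (enc a) (enc l)) (enc (a :: l)).size := RunsIn.id
    exact (h.cond_true (RunsIn.nil.pair RunsIn.head)).mono (by omega)

theorem isEmpty {f : α → List β} (hf : PolyTime f) : PolyTime fun a => (f a).isEmpty := by
  refine comp (g := List.isEmpty) ⟨.cond .id .nil (.pair .nil .nil), 8 * .X, fun O l => ?_⟩ hf
  rw [show (8 * Polynomial.X : Polynomial ℕ).eval (sz l) = 8 * (enc l).size by simp [sz]]
  rcases l with _ | ⟨a, l⟩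
  · have h : RunsIn O .id (enc ([] : List β)) .nil (enc ([] : List β)).size := RunsIn.id
    exact (h.cond_false (RunsIn.nil.pair RunsIn.nil)).mono (by omega)
  · have h : RunsIn O .id (enc (a :: l)) (.cons (enc a) (enc l)) (enc (a :: l)).size := RunsIn.id
    exact (h.cond_true RunsIn.nil).mono (by omega)

theorem succ {f : α → ℕ} (hf : PolyTime f) : PolyTime fun a => f a + 1 := by
  obtain ⟨P, p, hf⟩ := hf
  refine ⟨.pair .nil P, .X + .X + p, fun O a => ?_⟩
  exact (RunsIn.nil.pair (hf O a)).mono (by simp [sz])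

theorem pred {f : α → ℕ} (hf : PolyTime f) : PolyTime fun a => f a - 1 := by
  refine comp (g := fun n : ℕ => n - 1) (of_linear .tail fun O n => ?_) hf
  cases n <;> exact RunsIn.tail.mono (Nat.le_mul_of_pos_left _ (by omega))

theorem eqZero {f : α → ℕ} (hf : PolyTime f) : PolyTime fun a => f a == 0 := by
  refine comp (g := fun n : ℕ => n == 0) ⟨.cond .id .nil (.pair .nil .nil), 8 * .X, fun O n => ?_⟩
    hf
  rw [show (8 * Polynomial.X : Polynomial ℕ).eval (sz n) = 8 * (enc n).size by simp [sz]]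
  rcases n with _ | n
  · have h : RunsIn O .id (enc 0) .nil (enc 0).size := RunsIn.id
    exact (h.cond_false (RunsIn.nil.pair RunsIn.nil)).mono (by omega)
  · have h : RunsIn O .id (enc (n + 1)) (.cons .nil (enc n)) (enc (n + 1)).size := RunsIn.id
    exact (h.cond_true RunsIn.nil).mono (by omega)

theorem not {f : α → Bool} (hf : PolyTime f) : PolyTime fun a => !f a := by
  convert hf.ite (const false) (const true) using 2 with a
  cases f a <;> rfl

theorem and {f g : α → Bool} (hf : PolyTime f) (hg : PolyTime g) :
    PolyTime fun a => f a && g a := by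
  convert hf.ite hg (const false) using 2 with a
  cases f a <;> rfl

theorem or {f g : α → Bool} (hf : PolyTime f) (hg : PolyTime g) :
    PolyTime fun a => f a || g a := by
  convert hf.ite (const true) hg using 2 with a
  cases f a <;> rfl

theorem xor {f g : α → Bool} (hf : PolyTime f) (hg : PolyTime g) :
    PolyTime fun a => f a ^^ g a := by
  convert hf.ite hg.not hg using 2 with a
  cases f a <;> simp

/-- The loop that folds a list: the state consists of a parameter, the rest of the list and the
accumulator. -/
def foldProg (S : Prog) : Prog :=
  .while (.seq .tail .head)
    (.pair .head (.pair (.seq .tail (.seq .head .tail))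
      (.seq (.pair .head (.pair (.seq .tail (.seq .head .head)) (.seq .tail .tail))) S)))

/-- Here `G` bounds the size of the intermediate accumulators and `B` the size of the states. -/
theorem runsIn_foldProg {O : Data → Data} {S : Prog} {p : Polynomial ℕ} {step : α → β → σ → σ}
    (hS : ∀ z : α × β × σ, RunsIn O S (enc z) (enc (step z.1 z.2.1 z.2.2)) (p.eval (sz z)))
    {x : α} {G B : ℕ} (l : List β) (s : σ)
    (hG : ∀ l₁ l₂, l = l₁ ++ l₂ → sz (l₁.foldl (fun s a => step x a s) s) ≤ G)
    (hB : sz x + sz l + G + 2 ≤ B) :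
    RunsIn O (foldProg S) (enc (x, l, s))
      (enc (x, ([] : List β), l.foldl (fun s a => step x a s) s))
      ((l.length + 1) * (32 * B + p.eval B)) := by
  induction l generalizing s with
  | nil =>
    have h : RunsIn O (.seq .tail .head) (enc (x, ([] : List β), s)) .nil _ :=
      RunsIn.tail.seq RunsIn.head
    refine h.while_of_nil.mono ?_
    have h1 : (enc (x, ([] : List β), s)).size = sz x + (1 + sz s + 1) + 1 := rfl
    have h2 : (enc (x, ([] : List β), s)).tail.size = 1 + sz s + 1 := rfl
    have h3 : sz s ≤ G := hG [] [] rfl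
    simp only [sz_nil, List.length_nil] at hB ⊢
    omega
  | cons a l ih =>
    have hN : (enc (x, a :: l, s)).size = sz x + (sz a + sz l + 1 + sz s + 1) + 1 := rfl
    have hC : RunsIn O (.seq .tail .head) (enc (x, a :: l, s)) (.cons (enc a) (enc l)) _ :=
      RunsIn.tail.seq RunsIn.head
    have harg : RunsIn O
        (.pair .head (.pair (.seq .tail (.seq .head .head)) (.seq .tail .tail)))
        (enc (x, a :: l, s)) (enc (x, a, s)) _ :=
      RunsIn.head.pair ((RunsIn.tail.seq (RunsIn.head.seq RunsIn.head)).pair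
        (RunsIn.tail.seq RunsIn.tail))
    have hbody := (RunsIn.head (O := O) (x := enc (x, a :: l, s))).pair
      ((RunsIn.tail.seq (RunsIn.head.seq RunsIn.tail)).pair (harg.seq (hS (x, a, s))))
    have hs : sz s ≤ G := hG [] (a :: l) rfl
    have hstep : sz (step x a s) ≤ G := hG [a] l rfl
    simp only [sz_cons] at hB
    have hrest := ih (step x a s) (fun l₁ l₂ h => hG (a :: l₁) l₂ (by rw [h]; rfl)) (by omega)
    refine (RunsIn.while_step hC hbody hrest).mono ?_
    have hp : p.eval (sz (x, a, s)) ≤ p.eval B :=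
      polynomial_eval_mono p (by simp only [sz_prod]; omega)
    have e1 : (enc (x, a :: l, s)).tail.size = sz a + sz l + 1 + sz s + 1 := rfl
    have e2 : (enc (x, a :: l, s)).tail.head.size = sz a + sz l + 1 := rfl
    have e3 : (enc (x, a :: l, s)).head.size = sz x := rfl
    simp only [List.length_cons, Nat.add_mul (l.length + 1), one_mul, hN, e1, e2]
    omega

/-- Folding a list takes polynomial time if each step does and the intermediate results have
polynomial size. -/
theorem foldl_of_bound {l : α → List β} {s₀ : α → σ} {step : α → β → σ → σ} (hl : PolyTime l)
    (hs : PolyTime s₀) (hstep : PolyTime fun z : α × β × σ => step z.1 z.2.1 z.2.2)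
    (hbound : ∃ q : Polynomial ℕ, ∀ x l₁ l₂, l x = l₁ ++ l₂ →
      sz (l₁.foldl (fun s a => step x a s) (s₀ x)) ≤ q.eval (sz x)) :
    PolyTime fun x => (l x).foldl (fun s a => step x a s) (s₀ x) := by
  obtain ⟨Pl, pl, hl⟩ := hl
  obtain ⟨Ps, ps, hs⟩ := hs
  obtain ⟨S, p, hS⟩ := hstep
  obtain ⟨q, hq⟩ := hbound
  let B : Polynomial ℕ := .X + pl + q + 2
  refine ⟨.seq (.seq (.pair .id (.pair Pl Ps)) (foldProg S)) (.seq .tail .tail),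
    8 * B + (8 * pl + 8 * ps + 8 * .X) + 8 * ((pl + 1) * (32 * B + p.comp B)), fun O x => ?_⟩
  have hlx := hl O x
  have hsx := hs O x
  have hinit : RunsIn O (.pair .id (.pair Pl Ps)) (enc x) (enc (x, l x, s₀ x)) _ :=
    RunsIn.id.pair (hlx.pair hsx)
  have hlen := (length_le_sz (l x)).trans hlx.size_le
  have hB : sz x + sz (l x) + q.eval (sz x) + 2 ≤ B.eval (sz x) := by
    simp only [B, Polynomial.eval_add, Polynomial.eval_X, Polynomial.eval_ofNat]
    have h2 : sz (l x) ≤ _ := hlx.size_le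
    omega
  have hfold := runsIn_foldProg (step := step) (hS O) (l x) (s₀ x) (hq x) hB
  have hrun := (hinit.seq hfold).seq ((RunsIn.tail (O := O)).seq RunsIn.tail)
  refine hrun.mono ?_
  have e1 := hinit.size_le
  have e2 := hfold.size_le
  have e4 := Data.size_tail_le (enc (x, ([] : List β), (l x).foldl (fun s a => step x a s) (s₀ x)))
  have e5 : ((l x).length + 1) * (32 * B.eval (sz x) + p.eval (B.eval (sz x))) ≤
      (pl.eval (sz x) + 1) * (32 * B.eval (sz x) + p.eval (B.eval (sz x))) :=
    Nat.mul_le_mul_right _ (by omega)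
  simp only [Polynomial.eval_add, Polynomial.eval_X, Polynomial.eval_mul, Polynomial.eval_comp,
    Polynomial.eval_ofNat, Polynomial.eval_one] at e5 ⊢
  simp only [sz] at *
  omega

/-- Folding a list takes polynomial time if each step does and adds a polynomial amount, bounded
independently of the accumulator, to the size of the accumulator. -/
theorem foldl {l : α → List β} {s₀ : α → σ} {step : α → β → σ → σ} (hl : PolyTime l)
    (hs : PolyTime s₀) (hstep : PolyTime fun z : α × β × σ => step z.1 z.2.1 z.2.2)
    (hgrow : ∃ q : Polynomial ℕ, ∀ x a s, sz (step x a s) ≤ sz s + q.eval (sz x + sz a)) :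
    PolyTime fun x => (l x).foldl (fun s a => step x a s) (s₀ x) := by
  refine foldl_of_bound hl hs hstep ?_
  obtain ⟨pl, hpl⟩ := hl.exists_size_le
  obtain ⟨ps, hps⟩ := hs.exists_size_le
  obtain ⟨q, hq⟩ := hgrow
  have key : ∀ x (l₁ : List β), (∀ a ∈ l₁, sz a ≤ pl.eval (sz x)) → ∀ s,
      sz (l₁.foldl (fun s a => step x a s) s) ≤
        sz s + l₁.length * q.eval (sz x + pl.eval (sz x)) := by
    intro x l₁
    induction l₁ with
    | nil => intro _ s; simp
    | cons a l₁ ih =>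
      intro h s
      have h1 := ih (fun b hb => h b (List.mem_cons_of_mem _ hb)) (step x a s)
      have h2 := polynomial_eval_mono q (Nat.add_le_add_left (h a List.mem_cons_self) (sz x))
      have h3 := hq x a s
      simp only [List.foldl_cons, List.length_cons, Nat.add_mul, one_mul]
      omega
  refine ⟨ps + pl * q.comp (.X + pl), fun x l₁ l₂ h => ?_⟩
  have hmem : ∀ a ∈ l₁, sz a ≤ pl.eval (sz x) := fun a ha =>
    (sz_le_of_mem (by rw [h]; exact List.mem_append_left _ ha)).trans (hpl x)
  have hlen : l₁.length ≤ pl.eval (sz x) := by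
    have h1 := (length_le_sz (l x)).trans (hpl x)
    rw [h, List.length_append] at h1
    omega
  refine (key x l₁ hmem (s₀ x)).trans ?_
  simp only [Polynomial.eval_add, Polynomial.eval_X, Polynomial.eval_mul, Polynomial.eval_comp]
  exact Nat.add_le_add (hps x) (Nat.mul_le_mul_right _ hlen)

end PolyTime

namespace PolyTime

/-! ### Operations on lists and unary numbers -/

theorem foldl_cons_eq {β : Type} (l s : List β) :
    l.foldl (fun s a => a :: s) s = l.reverse ++ s := by
  induction l generalizing s with
  | nil => rfl
  | cons a l ih => simp [ih]

theorem reverse {f : α → List β} (hf : PolyTime f) : PolyTime fun x => (f x).reverse := by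
  have := foldl (s₀ := fun _ => ([] : List β)) (step := fun _ a s => a :: s) hf (const [])
    (cons PolyTime.id.snd.fst PolyTime.id.snd.snd)
    ⟨.X + 1, fun x a s => by simp; omega⟩
  simpa [foldl_cons_eq] using this

theorem append {f g : α → List β} (hf : PolyTime f) (hg : PolyTime g) :
    PolyTime fun x => f x ++ g x := by
  have := foldl (step := fun _ a s => a :: s) hf.reverse hg
    (cons PolyTime.id.snd.fst PolyTime.id.snd.snd)
    ⟨.X + 1, fun x a s => by simp; omega⟩
  simpa [foldl_cons_eq] using this

theorem flatMap {f : α → List β} {g : α → β → List γ} (hf : PolyTime f)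
    (hg : PolyTime fun z : α × β => g z.1 z.2) : PolyTime fun x => (f x).flatMap (g x) := by
  obtain ⟨q, hq⟩ := hg.exists_size_le
  have := foldl (s₀ := fun _ => ([] : List γ)) (step := fun x a s => s ++ g x a) hf (const [])
    (append PolyTime.id.snd.snd (hg.comp (PolyTime.id.fst.pair PolyTime.id.snd.fst)))
    ⟨q.comp (.X + 1), fun x a s => (sz_append _ _).trans (by
      have := hq (x, a)
      simp only [sz_prod] at this
      simpa using this)⟩
  simpa [List.flatMap_eq_foldl] using this

theorem map {f : α → List β} {g : α → β → γ} (hf : PolyTime f)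
    (hg : PolyTime fun z : α × β => g z.1 z.2) : PolyTime fun x => (f x).map (g x) := by
  simpa only [List.map_eq_flatMap] using hf.flatMap (g := fun x a => [g x a]) (hg.cons (const []))

theorem filter {f : α → List β} {g : α → β → Bool} (hf : PolyTime f)
    (hg : PolyTime fun z : α × β => g z.1 z.2) : PolyTime fun x => (f x).filter (g x) := by
  have := hf.flatMap (g := fun x a => if g x a then [a] else [])
    (hg.ite (PolyTime.id.snd.cons (const [])) (const []))
  convert this using 2 with x
  induction f x with
  | nil => rfl
  | cons a l ih => by_cases h : g x a <;> simp [h, ih]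

theorem sz_nat (n : ℕ) : sz n = 2 * n + 1 := by
  induction n with
  | zero => rfl
  | succ n ih => rw [sz_succ, ih]; ring

/-- Numbering the elements of a list. The number attached to an element is read off the accumulator,
so that `foldl` does not apply and the accumulators have to be bounded directly. -/
theorem zipIdx {f : α → List β} (hf : PolyTime f) : PolyTime fun x => (f x).zipIdx := by
  have hfold : ∀ (l : List β) (n : ℕ) (out : List (β × ℕ)),
      l.foldl (fun (s : ℕ × List (β × ℕ)) a => (s.1 + 1, (a, s.1) :: s.2)) (n, out) =
        (n + l.length, (l.zipIdx n).reverse ++ out) := by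
    intro l
    induction l with
    | nil => intro n out; simp
    | cons a l ih => intro n out; simp [ih, List.zipIdx_cons]; omega
  have hsz : ∀ (l : List β) (n : ℕ) (out : List (β × ℕ)),
      sz ((l.zipIdx n).reverse ++ out) ≤ sz out + sz l + l.length * (2 * (n + l.length) + 3) := by
    intro l
    induction l with
    | nil => intro n out; simp
    | cons a l ih =>
      intro n out
      have := ih (n + 1) ((a, n) :: out)
      simp only [sz_cons, sz_prod, sz_nat] at this
      simp only [List.zipIdx_cons, List.reverse_cons, List.append_assoc, List.singleton_append,
        sz_cons, List.length_cons]
      ring_nf at this ⊢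
      omega
  obtain ⟨q, hq⟩ := hf.exists_size_le
  have := foldl_of_bound (s₀ := fun _ => (0, ([] : List (β × ℕ))))
    (step := fun _ a s => (s.1 + 1, (a, s.1) :: s.2)) hf (const _)
    (pair PolyTime.id.snd.snd.fst.succ (cons (pair PolyTime.id.snd.fst PolyTime.id.snd.snd.fst)
      PolyTime.id.snd.snd.snd)) ⟨4 * q + q * (2 * q + 3) + 4, fun x l₁ l₂ h => by
        rw [hfold]
        have h1 := hsz l₁ 0 []
        have h2 := hq x
        have h3 : sz l₁ ≤ sz (f x) := by
          rw [h]
          clear h h1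
          induction l₁ with
          | nil => exact one_le_sz _
          | cons a l ih => simp only [List.cons_append, sz_cons]; omega
        have h4 := length_le_sz l₁
        have h5 : l₁.length * (2 * (0 + l₁.length) + 3) ≤
            q.eval (sz x) * (2 * q.eval (sz x) + 3) :=
          Nat.mul_le_mul (by omega) (by omega)
        simp only [sz_prod, sz_nat, Polynomial.eval_add, Polynomial.eval_mul,
          Polynomial.eval_ofNat]
        simp only [sz_nil] at h1
        omega⟩
  simpa [hfold] using this.snd.reverse

/-- A number in unary has the same encoding as the list of as many zeros. -/
theorem replicate_false {f : α → ℕ} (hf : PolyTime f) :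
    PolyTime fun x => List.replicate (f x) false := by
  obtain ⟨P, p, h⟩ := hf
  refine ⟨P, p, fun O a => ?_⟩
  have : ∀ n : ℕ, enc (List.replicate n false) = enc n := by
    intro n
    induction n with
    | zero => rfl
    | succ n ih => exact congrArg (Data.cons .nil) ih
  rw [this]
  exact h O a

theorem sub {f g : α → ℕ} (hf : PolyTime f) (hg : PolyTime g) : PolyTime fun x => f x - g x := by
  have := foldl (step := fun _ _ s => s - 1) hg.replicate_false hf PolyTime.id.snd.snd.pred
    ⟨0, fun x a s => by simp only [sz_nat]; omega⟩
  convert this using 2 with x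
  generalize f x = n
  generalize g x = m
  induction m generalizing n with
  | zero => rfl
  | succ m ih => rw [List.replicate_succ, List.foldl_cons, ← ih]; omega

theorem decideLT {f g : α → ℕ} (hf : PolyTime f) (hg : PolyTime g) :
    PolyTime fun x => decide (f x < g x) := by
  convert (hg.sub hf).eqZero.not using 2 with x
  by_cases h : f x < g x <;> simp [h] <;> omega

theorem natBeq {f g : α → ℕ} (hf : PolyTime f) (hg : PolyTime g) :
    PolyTime fun x => f x == g x := by
  convert (hg.sub hf).eqZero.and (hf.sub hg).eqZero using 2 with x
  rw [Bool.eq_iff_iff]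
  simp only [beq_iff_eq, Bool.and_eq_true]
  omega

theorem prodBeq {β γ : Type} [BEq β] [BEq γ] {f g : α → β × γ}
    (h₁ : PolyTime fun x => (f x).1 == (g x).1) (h₂ : PolyTime fun x => (f x).2 == (g x).2) :
    PolyTime fun x => f x == g x := h₁.and h₂

end PolyTime

/-! ### Binary arithmetic -/

/-- The value of a list of bits, least significant bit first. -/
def bitsVal : List Bool → ℕ
  | [] => 0
  | b :: l => Nat.bit b (bitsVal l)

theorem bitsVal_cons (b : Bool) (l : List Bool) : bitsVal (b :: l) = 2 * bitsVal l + b.toNat := by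
  rw [bitsVal, Nat.bit_val]

theorem bitsVal_bits (n : ℕ) : bitsVal n.bits = n := by
  induction n using Nat.binaryRec' with
  | zero => simp [bitsVal]
  | bit b n h ih => rw [Nat.bits_append_bit n b h, bitsVal, ih]

theorem bitsVal_lt (l : List Bool) : bitsVal l < 2 ^ l.length := by
  induction l with
  | nil => simp [bitsVal]
  | cons b l ih =>
    rw [bitsVal_cons, List.length_cons, pow_succ]
    cases b <;> simp <;> omega

theorem bitsVal_append (l l' : List Bool) :
    bitsVal (l ++ l') = bitsVal l + 2 ^ l.length * bitsVal l' := by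
  induction l with
  | nil => simp [bitsVal]
  | cons b l ih => rw [List.cons_append, bitsVal_cons, bitsVal_cons, ih, List.length_cons]; ring

@[simp] theorem bitsVal_replicate_false (n : ℕ) : bitsVal (List.replicate n false) = 0 := by
  induction n with
  | zero => rfl
  | succ n ih => simp [List.replicate_succ, bitsVal_cons, ih]

/-- The list without the zeros at its most significant end. This is the canonical binary expansion
of its value, `trim_eq_bits`. -/
def trim (l : List Bool) : List Bool :=
  l.foldr (fun b s => if !b && s.isEmpty then [] else b :: s) []

theorem trim_eq_bits (l : List Bool) : trim l = (bitsVal l).bits := by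
  induction l with
  | nil => simp [trim, bitsVal]
  | cons b l ih =>
    have h : trim (b :: l) = if !b && (trim l).isEmpty then [] else b :: trim l := rfl
    rw [h, ih, bitsVal]
    by_cases hl : bitsVal l = 0
    · cases b
      · simp [hl]
      · simp [hl]
    · have : (bitsVal l).bits ≠ [] := fun h0 => hl (by rw [← bitsVal_bits (bitsVal l), h0]; rfl)
      rw [Nat.bits_append_bit _ _ fun h0 => absurd h0 hl]
      simp [this]

/-- Addition with carry of two numbers in binary, up to the length of the second list. -/
def addBits : List Bool → List Bool → Bool → List Bool
  | _, [], _ => []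
  | a, b :: l, c =>
    (a.headD false ^^ (b ^^ c)) ::
      addBits a.tail l (a.headD false && b || c && (a.headD false ^^ b))

theorem bitsVal_tail (a : List Bool) : bitsVal a = 2 * bitsVal a.tail + (a.headD false).toNat := by
  cases a
  · rfl
  · rw [bitsVal_cons]; rfl

theorem length_addBits (a l : List Bool) (c : Bool) : (addBits a l c).length = l.length := by
  induction l generalizing a c with
  | nil => rfl
  | cons b l ih => simp [addBits, ih]

theorem bitsVal_addBits (a l : List Bool) (c : Bool) :
    bitsVal (addBits a l c) = (bitsVal a + bitsVal l + c.toNat) % 2 ^ l.length := by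
  induction l generalizing a c with
  | nil => simp [addBits, bitsVal, Nat.mod_one]
  | cons b l ih =>
    rw [addBits, bitsVal_cons, ih, bitsVal_tail a, bitsVal_cons, List.length_cons, pow_succ']
    generalize bitsVal a.tail = u
    generalize bitsVal l = v
    generalize a.headD false = d
    have key : ∀ x k r : ℕ, r < 2 → 2 * (x % k) + r = (2 * x + r) % (2 * k) := by
      intro x k r hr
      have h2 : r / 2 = 0 := by omega
      have h3 : r % 2 = r := by omega
      rw [Nat.mod_mul, Nat.mul_add_mod, Nat.mul_add_div (by omega), h2, h3, add_zero]
      omega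
    rw [key _ _ _ (Bool.toNat_lt _)]
    congr 1
    cases b <;> cases c <;> cases d <;> simp <;> omega

/-- The sum of two numbers in binary. The second one is padded with so many zeros that no carry is
lost. -/
def binAdd (a b : List Bool) : List Bool :=
  addBits a (b ++ (a.map (fun _ => false) ++ [false])) false

theorem length_binAdd (a b : List Bool) : (binAdd a b).length = a.length + b.length + 1 := by
  simp [binAdd, length_addBits]; omega

theorem bitsVal_binAdd (a b : List Bool) : bitsVal (binAdd a b) = bitsVal a + bitsVal b := by
  rw [binAdd, bitsVal_addBits]
  have h : bitsVal (b ++ (a.map (fun _ => false) ++ [false])) = bitsVal b := by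
    simp [bitsVal_append, bitsVal]
  rw [h, Bool.toNat_false, add_zero, Nat.mod_eq_of_lt]
  have ha := bitsVal_lt a
  have hb := bitsVal_lt b
  have h1 : 2 ^ a.length ≤ 2 ^ (a.length + b.length) := Nat.pow_le_pow_right (by omega) (by omega)
  have h2 : 2 ^ b.length ≤ 2 ^ (a.length + b.length) := Nat.pow_le_pow_right (by omega) (by omega)
  have h3 : (b ++ (a.map (fun _ => false) ++ [false])).length = a.length + b.length + 1 := by
    simp; omega
  rw [h3, pow_succ]
  omega

/-- Division by two modulo the odd number `M`: an odd number is made even by adding `M`. -/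
def halveMod (M x : List Bool) : List Bool :=
  if x.headD false then (binAdd x M).tail else x.tail

theorem length_halveMod_le (M x : List Bool) : (halveMod M x).length ≤ x.length + M.length := by
  rw [halveMod]
  split_ifs
  · simp [length_binAdd]
  · simp; omega

theorem two_mul_bitsVal_halveMod {M : List Bool} (hM : bitsVal M % 2 = 1) (x : List Bool) :
    2 * bitsVal (halveMod M x) = bitsVal x ∨
      2 * bitsVal (halveMod M x) = bitsVal x + bitsVal M := by
  have hx := bitsVal_tail x
  rw [halveMod]
  cases h : x.headD false
  · left
    rw [h] at hx
    simpa using hx.symm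
  · right
    have h2 := bitsVal_tail (binAdd x M)
    rw [bitsVal_binAdd] at h2
    rw [h] at hx
    simp only [Bool.toNat_true] at hx
    have h3 : ((binAdd x M).headD false).toNat < 2 := Bool.toNat_lt _
    simp only [if_true]
    omega

/-- Repeated division by two modulo `M`, once for each entry of `l`. -/
def halveModIter (M l x : List Bool) : List Bool := l.foldl (fun x _ => halveMod M x) x

theorem length_halveModIter_le (M l x : List Bool) :
    (halveModIter M l x).length ≤ x.length + l.length * M.length := by
  induction l generalizing x with
  | nil => simp [halveModIter]
  | cons b l ih =>
    have h1 := ih (halveMod M x)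
    have h2 := length_halveMod_le M x
    simp only [halveModIter, List.foldl_cons, List.length_cons, Nat.add_mul] at h1 ⊢
    omega

/-- The result is the quotient modulo `M`, and it is at most `M` if `x` is at most `2 ^ l.length`. -/
theorem halveModIter_spec {M : List Bool} (hM : bitsVal M % 2 = 1) (l x : List Bool) :
    2 ^ l.length * bitsVal (halveModIter M l x) ≡ bitsVal x [MOD bitsVal M] ∧
      2 ^ l.length * bitsVal (halveModIter M l x) + bitsVal M ≤
        bitsVal x + 2 ^ l.length * bitsVal M := by
  induction l generalizing x with
  | nil => simp [halveModIter, Nat.ModEq.refl]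
  | cons b l ih =>
    obtain ⟨h1, h2⟩ := ih (halveMod M x)
    have h3 := two_mul_bitsVal_halveMod hM x
    change 2 ^ (l.length + 1) * bitsVal (halveModIter M l (halveMod M x)) ≡ _ [MOD _] ∧
      2 ^ (l.length + 1) * bitsVal (halveModIter M l (halveMod M x)) + _ ≤
        _ + 2 ^ (l.length + 1) * _
    generalize bitsVal (halveModIter M l (halveMod M x)) = w at *
    rw [pow_succ', mul_assoc, mul_assoc]
    constructor
    · refine (h1.mul_left 2).trans ?_
      rcases h3 with h3 | h3 <;> rw [h3]
      exact Nat.add_mod_right _ _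
    · omega

namespace PolyTime

theorem trim {f : α → List Bool} (hf : PolyTime f) : PolyTime fun x => trim (f x) := by
  have := foldl (s₀ := fun _ => ([] : List Bool))
    (step := fun _ b s => if !b && s.isEmpty then [] else b :: s) hf.reverse (const _)
    (ite (and (not PolyTime.id.snd.fst) (isEmpty PolyTime.id.snd.snd)) (const _)
      (cons PolyTime.id.snd.fst PolyTime.id.snd.snd))
    ⟨.X + 2, fun x a s => by
      have := one_le_sz s
      split_ifs <;> simp <;> omega⟩
  simpa [MatchingReduction.trim] using this

theorem addBits {f g : α → List Bool} (hf : PolyTime f) (hg : PolyTime g) :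
    PolyTime fun x => addBits (f x) (g x) false := by
  let step (b : Bool) (s : List Bool × Bool × List Bool) : List Bool × Bool × List Bool :=
    (s.1.tail, s.1.headD false && b || s.2.1 && (s.1.headD false ^^ b),
      (s.1.headD false ^^ (b ^^ s.2.1)) :: s.2.2)
  have hfold : ∀ (l a out : List Bool) (c : Bool), (l.foldl (fun s b => step b s) (a, c, out)).2.2 =
      (MatchingReduction.addBits a l c).reverse ++ out := by
    intro l
    induction l with
    | nil => intro a out c; rfl
    | cons b l ih =>
      intro a out c
      rw [List.foldl_cons, ih, MatchingReduction.addBits, List.reverse_cons, List.append_assoc]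
      rfl
  have ha : PolyTime fun z : α × Bool × List Bool × Bool × List Bool => z.2.2.1 :=
    PolyTime.id.snd.snd.fst
  have hb : PolyTime fun z : α × Bool × List Bool × Bool × List Bool => z.2.1 :=
    PolyTime.id.snd.fst
  have hc : PolyTime fun z : α × Bool × List Bool × Bool × List Bool => z.2.2.2.1 :=
    PolyTime.id.snd.snd.snd.fst
  have hout : PolyTime fun z : α × Bool × List Bool × Bool × List Bool => z.2.2.2.2 :=
    PolyTime.id.snd.snd.snd.snd
  have hd := ha.headD_false
  have hs : PolyTime fun z : α × Bool × List Bool × Bool × List Bool => step z.2.1 z.2.2 :=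
    ha.tail.pair (((hd.and hb).or (hc.and (hd.xor hb))).pair ((hd.xor (hb.xor hc)).cons hout))
  have := foldl (s₀ := fun x => (f x, false, ([] : List Bool))) (step := fun _ b s => step b s) hg
    (hf.pair (const _)) hs ⟨8, fun x a s => by
      obtain ⟨s1, s2, s3⟩ := s
      have h1 : sz s1.tail ≤ sz s1 := by
        cases s1
        · exact le_rfl
        · simp only [List.tail_cons, sz_cons]; omega
      have h2 := sz_bool_le (s1.headD false && a || s2 && (s1.headD false ^^ a))
      have h3 := sz_bool_le (s1.headD false ^^ (a ^^ s2))
      have h4 := one_le_sz s2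
      simp only [step, sz_prod, sz_cons, Polynomial.eval_ofNat]
      omega⟩
  simpa [hfold] using this.snd.snd.reverse

theorem binAdd {f g : α → List Bool} (hf : PolyTime f) (hg : PolyTime g) :
    PolyTime fun x => binAdd (f x) (g x) :=
  hf.addBits (hg.append ((hf.map (g := fun _ _ => false) (const _)).append (const _)))

theorem halveMod {f g : α → List Bool} (hf : PolyTime f) (hg : PolyTime g) :
    PolyTime fun x => halveMod (f x) (g x) :=
  hg.headD_false.ite (hg.binAdd hf).tail hg.tail

theorem halveModIter {f g h : α → List Bool} (hf : PolyTime f) (hg : PolyTime g)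
    (hh : PolyTime h) : PolyTime fun x => halveModIter (f x) (g x) (h x) := by
  obtain ⟨pf, hpf⟩ := hf.exists_size_le
  obtain ⟨pg, hpg⟩ := hg.exists_size_le
  obtain ⟨ph, hph⟩ := hh.exists_size_le
  refine foldl_of_bound (step := fun x _ s => MatchingReduction.halveMod (f x) s) hg hh
    ((hf.comp PolyTime.id.fst).halveMod PolyTime.id.snd.snd) ⟨4 * (ph + pg * pf) + 1, ?_⟩
  intro x l₁ l₂ hl
  -- zeros and ones have encodings of different sizes, so the length is the quantity to control
  refine (sz_bits_le _).trans ?_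
  have h1 := length_halveModIter_le (f x) l₁ (h x)
  have h2 : l₁.length * (f x).length ≤ pg.eval (sz x) * pf.eval (sz x) := by
    refine Nat.mul_le_mul ?_ ((length_le_sz _).trans (hpf x))
    have := (length_le_sz (g x)).trans (hpg x)
    rw [hl, List.length_append] at this
    omega
  have h3 := (length_le_sz (h x)).trans (hph x)
  simp only [MatchingReduction.halveModIter] at h1
  simp only [Polynomial.eval_add, Polynomial.eval_mul, Polynomial.eval_ofNat, Polynomial.eval_one]
  omega

end PolyTime

/-! ### The two phases of the reduction as algorithms -/

/-- A rational number as sign, absolute value of the numerator, and denominator. -/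
abbrev RatCode : Type := (Bool × List Bool) × List Bool

/-- The names of the vertices of the subdivision: `(i, i, 0)` for the vertex `i` of the given graph,
and `(i, j, k)` for the `k`-th vertex on the path that replaces the edge `{i, j}`, where `i < j` and
`1 ≤ k ≤ 5`. -/
abbrev VertexCode : Type := ℕ × ℕ × ℕ

/-- The edges `{i, j}`, `i < j`, of the graph with the given adjacency matrix. -/
def edgeList (A : List (List Bool)) : List (ℕ × ℕ) :=
  A.zipIdx.flatMap fun r =>
    (r.1.zipIdx.filter fun b => b.1 && decide (r.2 < b.2)).map fun b => (r.2, b.2)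

/-- The names of the vertices of the subdivision. -/
def vertexList (A : List (List Bool)) : List VertexCode :=
  A.zipIdx.map (fun r => (r.2, r.2, 0)) ++
    (edgeList A).flatMap fun e => [1, 2, 3, 4, 5].map fun k => (e.1, e.2, k)

/-- The name of the `k`-th vertex, `0 ≤ k ≤ 6`, on the path that replaces an edge. -/
def pathCode (e : ℕ × ℕ) (k : ℕ) : VertexCode :=
  if k == 0 then (e.1, e.1, 0) else if k == 6 then (e.2, e.2, 0) else (e.1, e.2, k)

/-- The binary expansion of `2 ^ (k + l.length)`. -/
def powTwoBits {β : Type} (k : ℕ) (l : List β) : List Bool :=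
  List.replicate k false ++ (l.map (fun _ => false) ++ [true])

/-- The probabilities of the six edges of each path, for a graph with edge list `E`. -/
def probCodes {β : Type} (E : List β) : List RatCode :=
  [((false, [true, true]), powTwoBits 3 E),
    ((false, [true, true]), [false, false, true]),
    ((false, [true, false, false, true]), powTwoBits 5 (E ++ E)),
    ((false, [true, true]), powTwoBits 3 E),
    ((false, [true, true, false, true, true]), powTwoBits 6 (E ++ E)),
    ((false, [true, true]), powTwoBits 4 (E ++ E))]

/-- The edges of the subdivision with their probabilities. -/
def weightedEdgeList (E : List (ℕ × ℕ)) : List ((VertexCode × VertexCode) × RatCode) :=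
  E.flatMap fun e => (probCodes E).zipIdx.map fun c => ((pathCode e c.2, pathCode e (c.2 + 1)), c.1)

/-- Look up the weight of the edge `{u, v}`. -/
def lookupEdge (W : List ((VertexCode × VertexCode) × RatCode)) (u v : VertexCode) :
    Option RatCode :=
  (W.filter fun w => (w.1.1 == u && w.1.2 == v) || (w.1.1 == v && w.1.2 == u)).head?.elim none
    fun w => some w.2

/-- The query: the weighted adjacency matrix of the subdivision of the graph with adjacency
matrix `A`. -/
def queryMatrix (A : List (List Bool)) : List (List (Option RatCode)) :=
  (vertexList A).map fun u => (vertexList A).map fun v =>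
    lookupEdge (weightedEdgeList (edgeList A)) u v

/-- The binary expansion of `2 ^ (m + 3) + 3`, where `m` is the length of `E`. -/
def modulusBits {β : Type} (E : List β) : List Bool :=
  true :: true :: false :: (E.map (fun _ => false) ++ [true])

/-- The number of matchings, from the edge list and the answer of the oracle: if the answer is
`a / 2 ^ s` and there are `m` edges, this is `a / 2 ^ (s + m)` modulo `2 ^ (m + 3) + 3`. -/
def decodeAnswer {β : Type} (E : List β) (q : RatCode) : List Bool :=
  trim (halveModIter (modulusBits E) (q.2.tail ++ E.map fun _ => false) q.1.2)

namespace PolyTime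

theorem edgeList {f : α → List (List Bool)} (hf : PolyTime f) :
    PolyTime fun x => edgeList (f x) := by
  refine comp (g := MatchingReduction.edgeList) ?_ hf
  refine PolyTime.id.zipIdx.flatMap (map (filter (zipIdx PolyTime.id.snd.fst)
    (g := fun (z : List (List Bool) × List Bool × ℕ) b => b.1 && decide (z.2.2 < b.2)) ?_)
    (g := fun (z : List (List Bool) × List Bool × ℕ) b => (z.2.2, b.2)) ?_)
  · exact PolyTime.id.snd.fst.and (decideLT PolyTime.id.fst.snd.snd PolyTime.id.snd.snd)
  · exact PolyTime.id.fst.snd.snd.pair PolyTime.id.snd.snd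

theorem vertexList {f : α → List (List Bool)} (hf : PolyTime f) :
    PolyTime fun x => vertexList (f x) := by
  refine append (map hf.zipIdx (g := fun _ r => (r.2, r.2, 0)) ?_)
    (flatMap hf.edgeList (g := fun _ e => [1, 2, 3, 4, 5].map fun k => (e.1, e.2, k))
      (map (const _) (g := fun (z : α × ℕ × ℕ) k => (z.2.1, z.2.2, k)) ?_))
  · exact PolyTime.id.snd.snd.pair (PolyTime.id.snd.snd.pair (const 0))
  · exact PolyTime.id.fst.snd.fst.pair (PolyTime.id.fst.snd.snd.pair PolyTime.id.snd)

theorem pathCode {f : α → ℕ × ℕ} {g : α → ℕ} (hf : PolyTime f) (hg : PolyTime g) :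
    PolyTime fun x => pathCode (f x) (g x) :=
  (hg.natBeq (const 0)).ite (hf.fst.pair (hf.fst.pair (const 0)))
    ((hg.natBeq (const 6)).ite (hf.snd.pair (hf.snd.pair (const 0))) (hf.fst.pair (hf.snd.pair hg)))

theorem powTwoBits {f : α → List β} (k : ℕ) (hf : PolyTime f) :
    PolyTime fun x => powTwoBits k (f x) :=
  (const _).append ((hf.map (g := fun _ _ => false) (const _)).append (const _))

theorem probCodes {f : α → List β} (hf : PolyTime f) : PolyTime fun x => probCodes (f x) :=
  cons ((const _).pair (hf.powTwoBits 3)) <|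
    cons (const _) <|
    cons ((const _).pair ((hf.append hf).powTwoBits 5)) <|
    cons ((const _).pair (hf.powTwoBits 3)) <|
    cons ((const _).pair ((hf.append hf).powTwoBits 6)) <|
    cons ((const _).pair ((hf.append hf).powTwoBits 4)) (const [])

theorem weightedEdgeList {f : α → List (ℕ × ℕ)} (hf : PolyTime f) :
    PolyTime fun x => weightedEdgeList (f x) := by
  refine comp (g := MatchingReduction.weightedEdgeList) ?_ hf
  refine PolyTime.id.flatMap (g := fun E e => (MatchingReduction.probCodes E).zipIdx.map fun c =>
      ((MatchingReduction.pathCode e c.2, MatchingReduction.pathCode e (c.2 + 1)), c.1))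
    (map (zipIdx (probCodes PolyTime.id.fst)) (g := fun (z : List (ℕ × ℕ) × ℕ × ℕ) c =>
      ((MatchingReduction.pathCode z.2 c.2, MatchingReduction.pathCode z.2 (c.2 + 1)), c.1)) ?_)
  exact ((PolyTime.id.fst.snd.pathCode PolyTime.id.snd.snd).pair
    (PolyTime.id.fst.snd.pathCode PolyTime.id.snd.snd.succ)).pair PolyTime.id.snd.fst

theorem vertexCodeBeq {f g : α → VertexCode} (hf : PolyTime f) (hg : PolyTime g) :
    PolyTime fun x => f x == g x :=
  prodBeq (hf.fst.natBeq hg.fst)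
    (prodBeq (hf.snd.fst.natBeq hg.snd.fst) (hf.snd.snd.natBeq hg.snd.snd))

theorem lookupEdge {f : α → List ((VertexCode × VertexCode) × RatCode)} {g h : α → VertexCode}
    (hf : PolyTime f) (hg : PolyTime g) (hh : PolyTime h) :
    PolyTime fun x => lookupEdge (f x) (g x) (h x) := by
  refine optionElim (head? (filter hf (g := fun x w =>
    (w.1.1 == g x && w.1.2 == h x) || (w.1.1 == h x && w.1.2 == g x)) ?_)) (const none)
    (some PolyTime.id.snd.snd)
  have hg' := hg.comp (PolyTime.id (α := α × (VertexCode × VertexCode) × RatCode)).fst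
  have hh' := hh.comp (PolyTime.id (α := α × (VertexCode × VertexCode) × RatCode)).fst
  have hu := (PolyTime.id (α := α × (VertexCode × VertexCode) × RatCode)).snd.fst.fst
  have hv := (PolyTime.id (α := α × (VertexCode × VertexCode) × RatCode)).snd.fst.snd
  exact ((hu.vertexCodeBeq hg').and (hv.vertexCodeBeq hh')).or
    ((hu.vertexCodeBeq hh').and (hv.vertexCodeBeq hg'))

theorem queryMatrix : PolyTime queryMatrix :=
  map (vertexList PolyTime.id) (map (vertexList PolyTime.id.fst)
    (lookupEdge (weightedEdgeList (edgeList PolyTime.id.fst.fst)) PolyTime.id.fst.snd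
      PolyTime.id.snd))

theorem decodeAnswer {f : α → List β} {g : α → RatCode} (hf : PolyTime f) (hg : PolyTime g) :
    PolyTime fun x => decodeAnswer (f x) (g x) := by
  have hz : PolyTime fun x => (f x).map fun _ => false := hf.map (const _)
  have hM : PolyTime fun x => modulusBits (f x) :=
    cons (const true) (cons (const true) (cons (const false) (hz.append (const [true]))))
  exact (halveModIter hM (hg.snd.tail.append hz) hg.fst.snd).trim

end PolyTime

/-! ### Matchings of the subdivision -/

/-- A set of edges of the path of length six is a matching. -/
def PathIndep (S : Finset (Fin 6)) : Prop := ∀ i ∈ S, ∀ j ∈ S, (i : ℕ) + 1 ≠ j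

instance : DecidablePred PathIndep := fun S => by unfold PathIndep; infer_instance

/-- Whether the first and whether the last edge of the path of length six are chosen. -/
def pathEnds (S : Finset (Fin 6)) : Bool × Bool := (decide (0 ∈ S), decide (5 ∈ S))

/-- The weight of a set of edges of the path of length six, when the edge `k` has weight `a k` if
chosen and `b k` if not. -/
def pathWeight {R : Type} [CommRing R] (a b : Fin 6 → R) (S : Finset (Fin 6)) : R :=
  ∏ k, if k ∈ S then a k else b k

/-- The total weight of the matchings of the path of length six which contain the first and the
last edge as prescribed. -/
def gadgetWeight {R : Type} [CommRing R] (a b : Fin 6 → R) (s : Bool × Bool) : R :=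
  ∑ S with PathIndep S ∧ pathEnds S = s, pathWeight a b S

theorem gadgetWeight_eq {R : Type} [CommRing R] (a b : Fin 6 → R) :
    gadgetWeight a b (false, false) = b 0 * b 5 * (b 1 * b 2 * b 3 * b 4 + a 1 * b 2 * b 3 * b 4 +
      b 1 * a 2 * b 3 * b 4 + b 1 * b 2 * a 3 * b 4 + b 1 * b 2 * b 3 * a 4 +
      a 1 * b 2 * a 3 * b 4 + a 1 * b 2 * b 3 * a 4 + b 1 * a 2 * b 3 * a 4) ∧
    gadgetWeight a b (true, false) = a 0 * b 1 * b 5 * (b 2 * b 3 * b 4 + a 2 * b 3 * b 4 +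
      b 2 * a 3 * b 4 + b 2 * b 3 * a 4 + a 2 * b 3 * a 4) ∧
    gadgetWeight a b (false, true) = b 0 * b 4 * a 5 * (b 1 * b 2 * b 3 + a 1 * b 2 * b 3 +
      b 1 * a 2 * b 3 + b 1 * b 2 * a 3 + a 1 * b 2 * a 3) ∧
    gadgetWeight a b (true, true) =
      a 0 * b 1 * b 4 * a 5 * (b 2 * b 3 + a 2 * b 3 + b 2 * a 3) := by
  have h00 : (Finset.univ.filter fun S => PathIndep S ∧ pathEnds S = (false, false)) =
      {∅, {1}, {2}, {3}, {4}, {1, 3}, {1, 4}, {2, 4}} := by decide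
  have h10 : (Finset.univ.filter fun S => PathIndep S ∧ pathEnds S = (true, false)) =
      {{0}, {0, 2}, {0, 3}, {0, 4}, {0, 2, 4}} := by decide
  have h01 : (Finset.univ.filter fun S => PathIndep S ∧ pathEnds S = (false, true)) =
      {{5}, {1, 5}, {2, 5}, {3, 5}, {1, 3, 5}} := by decide
  have h11 : (Finset.univ.filter fun S => PathIndep S ∧ pathEnds S = (true, true)) =
      {{0, 5}, {0, 2, 5}, {0, 3, 5}} := by decide
  simp only [gadgetWeight, h00, h10, h01, h11]
  refine ⟨?_, ?_, ?_, ?_⟩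
  all_goals
    repeat rw [Finset.sum_insert (by decide)]
    rw [Finset.sum_singleton]
    simp [pathWeight, Fin.prod_univ_six]
    ring

open Classical in
/-- Choosing a matching of each path subject to a condition on the edges at their ends: the sum
factors over the paths. -/
theorem sum_prod_pathWeight {R E : Type} [CommRing R] [Fintype E] [DecidableEq E] (a b : Fin 6 → R)
    (V : (E → Bool × Bool) → Prop) :
    (∑ S : E → Finset (Fin 6) with (∀ e, PathIndep (S e)) ∧ V fun e => pathEnds (S e),
      ∏ e, pathWeight a b (S e)) = ∑ σ with V σ, ∏ e, gadgetWeight a b (σ e) := by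
  rw [← Finset.sum_fiberwise_of_maps_to (t := Finset.univ.filter fun σ => V σ)
    (g := fun (S : E → Finset (Fin 6)) e => pathEnds (S e)) (by simp)]
  refine Finset.sum_congr rfl fun σ hσ => ?_
  simp only [gadgetWeight]
  rw [Finset.prod_univ_sum]
  refine Finset.sum_congr ?_ fun _ _ => rfl
  ext S
  simp only [Finset.mem_filter, Finset.mem_univ, true_and, Fintype.mem_piFinset] at hσ ⊢
  constructor
  · rintro ⟨⟨h1, h2⟩, rfl⟩ e
    exact ⟨h1 e, rfl⟩
  · intro h
    obtain rfl : (fun e => pathEnds (S e)) = σ := funext fun e => (h e).2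
    exact ⟨⟨fun e => (h e).1, hσ⟩, rfl⟩

section Subdivision

variable {V : Type} [LinearOrder V] {H : SimpleGraph V}

/-- The two ends of an edge, the smaller one first. -/
def edgeEnd (e : H.edgeSet) (s : Bool) : V := if s then (e : Sym2 V).sup else (e : Sym2 V).inf

theorem mem_edge_iff (e : H.edgeSet) (v : V) : v ∈ (e : Sym2 V) ↔ ∃ s, v = edgeEnd e s := by
  obtain ⟨e, he⟩ := e
  induction e using Sym2.ind with
  | _ x y =>
    simp only [edgeEnd, Bool.exists_bool, Sym2.mem_iff, Sym2.inf_mk, Sym2.sup_mk]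
    rcases le_total x y with h | h <;> simp [h, or_comm]

theorem edgeEnd_injective (e : H.edgeSet) : Function.Injective (edgeEnd e) := by
  obtain ⟨e, he⟩ := e
  induction e using Sym2.ind with
  | _ x y =>
    have hne : x ≠ y := H.ne_of_adj he
    intro s s' h
    rcases le_total x y with hxy | hxy <;> cases s <;> cases s' <;>
      simp_all [edgeEnd, eq_comm]

/-- No vertex of `H` is met twice by the chosen edges at the ends of the paths, where `(σ e).1` says
whether the edge at the smaller end of the path for `e` is chosen, and `(σ e).2` whether the one at
the larger end is. -/
def EndsIndep (σ : H.edgeSet → Bool × Bool) : Prop :=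
  ∀ e e', e ≠ e' → ∀ s s', (if s then (σ e).2 else (σ e).1) = true →
    (if s' then (σ e').2 else (σ e').1) = true → edgeEnd e s ≠ edgeEnd e' s'

open Classical in
theorem endsIndep_iff_isMatching (M : Finset H.edgeSet) :
    EndsIndep (fun e => (decide (e ∈ M), decide (e ∈ M))) ↔ IsMatching M := by
  constructor
  · intro h e he e' he' hne v ⟨hv, hv'⟩
    obtain ⟨s, rfl⟩ := (mem_edge_iff e v).1 hv
    obtain ⟨s', hs'⟩ := (mem_edge_iff e' _).1 hv'
    exact h e e' hne s s' (by simpa using he) (by simpa using he') hs'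
  · intro h e e' hne s s' he he' heq
    exact h e (by simpa using he) e' (by simpa using he') hne (edgeEnd e s)
      ⟨(mem_edge_iff e _).2 ⟨s, rfl⟩, (mem_edge_iff e' _).2 ⟨s', heq⟩⟩

open Classical in
/-- If the path of length six behaves like a single edge, namely if its first and last edge are
always chosen together, then only the matchings of `H` contribute. -/
theorem sum_endsIndep_eq [Fintype V] {R : Type} [CommRing R] {a b : Fin 6 → R} {κ : R}
    (h00 : gadgetWeight a b (false, false) = κ) (h10 : gadgetWeight a b (true, false) = 0)
    (h01 : gadgetWeight a b (false, true) = 0) (h11 : gadgetWeight a b (true, true) = κ) :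
    (∑ σ : H.edgeSet → Bool × Bool with EndsIndep σ, ∏ e, gadgetWeight a b (σ e)) =
      κ ^ Fintype.card H.edgeSet * (matchings H).card := by
  have : (∑ M ∈ matchings H, κ ^ Fintype.card H.edgeSet) =
      ∑ σ : H.edgeSet → Bool × Bool with EndsIndep σ, ∏ e, gadgetWeight a b (σ e) := by
    refine Finset.sum_of_injOn (fun M e => (decide (e ∈ M), decide (e ∈ M))) ?_ ?_ ?_ ?_
    · intro M _ M' _ h
      ext e
      simpa using congrFun h e
    · intro M hM
      simpa [endsIndep_iff_isMatching, matchings] using hM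
    · intro σ hσ hσ'
      obtain ⟨e, he⟩ : ∃ e, (σ e).1 ≠ (σ e).2 := by
        by_contra! hall
        refine hσ' ⟨Finset.univ.filter fun e => (σ e).1 = true, ?_, ?_⟩
        · simp only [matchings, Finset.coe_filter, Finset.mem_univ, true_and, Set.mem_ofPred_eq]
          rw [← endsIndep_iff_isMatching]
          convert (Finset.mem_filter.1 hσ).2 with e
          · simp
          · simp [hall e]
        · funext e
          exact Prod.ext (by simp) (by simp [hall e])
      -- a path of which only one of the two end edges is chosen has weight zero
      refine Finset.prod_eq_zero (Finset.mem_univ e) ?_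
      rcases hx : σ e with ⟨x, y⟩
      rw [hx] at he
      cases x <;> cases y <;> simp_all
    · intro M _
      rw [Fintype.card, ← Finset.prod_const]
      refine Finset.prod_congr rfl fun e _ => ?_
      by_cases he : e ∈ M <;> simp [he, h00, h11]
  rw [← this, Finset.sum_const, nsmul_eq_mul, mul_comm]

theorem pathVertex_zero (e : H.edgeSet) :
    pathVertex H (fun _ => 6) e 0 = Sum.inl (edgeEnd e false) := rfl

theorem pathVertex_six (e : H.edgeSet) :
    pathVertex H (fun _ => 6) e 6 = Sum.inl (edgeEnd e true) := rfl

theorem pathVertex_inner (e : H.edgeSet) {k : ℕ} (h0 : 0 < k) (h6 : k < 6) :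
    pathVertex H (fun _ => 6) e k = Sum.inr ⟨e, ⟨k - 1, by change k - 1 < 5; omega⟩⟩ := by
  rw [pathVertex, if_neg (by omega), dif_pos]

/-- The paths of the subdivision meet only at their ends. -/
theorem eq_of_pathVertex_eq {e e' : H.edgeSet} {k k' : ℕ} (hk : k ≤ 6) (hk' : k' ≤ 6)
    (h : pathVertex H (fun _ => 6) e k = pathVertex H (fun _ => 6) e' k') :
    (e = e' ∧ k = k') ∨ ∃ s s' : Bool, k = (if s then 6 else 0) ∧ k' = (if s' then 6 else 0) ∧
      edgeEnd e s = edgeEnd e' s' := by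
  have key : ∀ k ≤ 6, k = 0 ∨ k = 6 ∨ (0 < k ∧ k < 6) := by omega
  rcases key k hk with rfl | rfl | ⟨h0, h6⟩ <;> rcases key k' hk' with rfl | rfl | ⟨h0', h6'⟩
  · exact Or.inr ⟨false, false, rfl, rfl, by
      simpa only [pathVertex_zero, Sum.inl.injEq] using h⟩
  · exact Or.inr ⟨false, true, rfl, rfl, by
      simpa only [pathVertex_zero, pathVertex_six, Sum.inl.injEq] using h⟩
  · simp [pathVertex_zero, pathVertex_inner _ h0' h6'] at h
  · exact Or.inr ⟨true, false, rfl, rfl, by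
      simpa only [pathVertex_zero, pathVertex_six, Sum.inl.injEq] using h⟩
  · exact Or.inr ⟨true, true, rfl, rfl, by
      simpa only [pathVertex_six, Sum.inl.injEq] using h⟩
  · simp [pathVertex_six, pathVertex_inner _ h0' h6'] at h
  · simp [pathVertex_zero, pathVertex_inner _ h0 h6] at h
  · simp [pathVertex_six, pathVertex_inner _ h0 h6] at h
  · rw [pathVertex_inner _ h0 h6, pathVertex_inner _ h0' h6'] at h
    have h1 := Sum.inr.inj h
    obtain rfl : e = e' := congrArg Sigma.fst h1
    have h2 := congrArg Fin.val (eq_of_heq (Sigma.mk.inj h1).2)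
    simp only at h2
    exact Or.inl ⟨rfl, by omega⟩

theorem pathVertex_ne_succ (e : H.edgeSet) {k : ℕ} (hk : k < 6) :
    pathVertex H (fun _ => 6) e k ≠ pathVertex H (fun _ => 6) e (k + 1) := by
  intro h
  rcases eq_of_pathVertex_eq (by omega) (by omega) h with ⟨_, h⟩ | ⟨s, s', h1, h2, _⟩
  · omega
  · cases s <;> cases s' <;> simp at h1 h2 <;> omega

/-- The edges of the subdivision, as a map on pairs of an edge of `H` and a position. -/
def subEdge (x : H.edgeSet × Fin 6) : (subdivision H fun _ => 6).edgeSet :=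
  ⟨s(pathVertex H (fun _ => 6) x.1 x.2, pathVertex H (fun _ => 6) x.1 (x.2 + 1)), by
    rw [subdivision, SimpleGraph.edgeSet_fromEdgeSet]
    exact ⟨⟨x.1, x.2, x.2.2, rfl⟩, pathVertex_ne_succ x.1 x.2.2⟩⟩

theorem subEdge_bijective : Function.Bijective (subEdge (H := H)) := by
  constructor
  · rintro ⟨e, k, hk⟩ ⟨e', k', hk'⟩ h
    have h' := congrArg Subtype.val h
    simp only [subEdge, Sym2.eq_iff] at h'
    suffices e = e' ∧ k = k' by
      obtain ⟨rfl, rfl⟩ := this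
      rfl
    -- every edge of a path has an inner vertex of this path
    rcases h' with ⟨h1, h2⟩ | ⟨h1, h2⟩
    all_goals
      rcases eq_of_pathVertex_eq (by omega) (by omega) h1 with ⟨r1, r2⟩ | ⟨s, s', r1, r2, _⟩ <;>
      rcases eq_of_pathVertex_eq (by omega) (by omega) h2 with ⟨r3, r4⟩ | ⟨t, t', r3, r4, _⟩ <;>
      first
      | exact ⟨by assumption, by omega⟩
      | (exfalso; split_ifs at * <;> omega)
  · rintro ⟨f, hf⟩
    have hf' := hf
    rw [subdivision, SimpleGraph.edgeSet_fromEdgeSet] at hf'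
    obtain ⟨⟨e, k, hk, rfl⟩, _⟩ := hf'
    exact ⟨(e, ⟨k, hk⟩), rfl⟩

variable {W : Type} {G : SimpleGraph W}

/-- The edges of a graph isomorphic to the subdivision. -/
noncomputable def isoEdge (φ : G ≃g subdivision H fun _ => 6) : H.edgeSet × Fin 6 ≃ G.edgeSet :=
  (Equiv.ofBijective subEdge subEdge_bijective).trans φ.mapEdgeSet.symm

theorem mem_isoEdge (φ : G ≃g subdivision H fun _ => 6) (x : H.edgeSet × Fin 6) (v : W) :
    v ∈ (isoEdge φ x : Sym2 W) ↔ φ v = pathVertex H (fun _ => 6) x.1 x.2 ∨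
      φ v = pathVertex H (fun _ => 6) x.1 (x.2 + 1) := by
  have h : φ.mapEdgeSet (isoEdge φ x) = subEdge x := φ.mapEdgeSet.apply_symm_apply _
  have h' : Sym2.map φ (isoEdge φ x : Sym2 W) = (subEdge x : Sym2 _) := congrArg Subtype.val h
  have h1 : v ∈ (isoEdge φ x : Sym2 W) ↔ φ v ∈ Sym2.map φ (isoEdge φ x : Sym2 W) := by
    rw [Sym2.mem_map]
    exact ⟨fun hv => ⟨v, hv, rfl⟩, fun ⟨w, hw, hwv⟩ => φ.injective hwv ▸ hw⟩
  rw [h1, h', subEdge, Sym2.mem_iff]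

open Classical in
/-- A set of edges of the subdivision is a matching if it is a matching on each path and the paths
do not conflict at the vertices of `H`. -/
theorem isMatching_iff_path (φ : G ≃g subdivision H fun _ => 6) (M : Finset G.edgeSet) :
    IsMatching M ↔ (∀ e, PathIndep (Finset.univ.filter fun k => isoEdge φ (e, k) ∈ M)) ∧
      EndsIndep fun e => pathEnds (Finset.univ.filter fun k => isoEdge φ (e, k) ∈ M) := by
  have hends : ∀ (e : H.edgeSet) (s : Bool),
      (if s then (pathEnds (Finset.univ.filter fun k => isoEdge φ (e, k) ∈ M)).2
        else (pathEnds (Finset.univ.filter fun k => isoEdge φ (e, k) ∈ M)).1) = true ↔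
      isoEdge φ (e, if s then 5 else 0) ∈ M := by
    intro e s
    cases s <;> simp [pathEnds]
  have hv : ∀ (e : H.edgeSet) (s : Bool),
      φ.symm (Sum.inl (edgeEnd e s)) ∈ (isoEdge φ (e, if s then 5 else 0) : Sym2 W) := by
    intro e s
    rw [mem_isoEdge]
    cases s
    · exact Or.inl (φ.apply_symm_apply _)
    · exact Or.inr (φ.apply_symm_apply _)
  constructor
  · intro h
    refine ⟨fun e i hi j hj hij => ?_, fun e e' hne s s' hs hs' heq => ?_⟩
    · simp only [Finset.mem_filter, Finset.mem_univ, true_and] at hi hj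
      refine h _ hi _ hj ?_ (φ.symm (pathVertex H (fun _ => 6) e j)) ⟨?_, ?_⟩
      · intro h0
        have := congrArg Prod.snd ((isoEdge φ).injective h0)
        simp only at this
        rw [this] at hij
        omega
      · rw [mem_isoEdge]; right; rw [φ.apply_symm_apply, hij]
      · rw [mem_isoEdge]; left; rw [φ.apply_symm_apply]
    · rw [hends] at hs hs'
      refine h _ hs _ hs' ?_ _ ⟨hv e s, heq ▸ hv e' s'⟩
      intro h0
      exact hne (congrArg Prod.fst ((isoEdge φ).injective h0))
  · rintro ⟨hpath, hend⟩ f hf f' hf' hne v ⟨hvf, hvf'⟩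
    obtain ⟨⟨e, k⟩, rfl⟩ := (isoEdge φ).surjective f
    obtain ⟨⟨e', k'⟩, rfl⟩ := (isoEdge φ).surjective f'
    rw [mem_isoEdge] at hvf hvf'
    obtain ⟨i, hi, hvi⟩ : ∃ i : ℕ, (i = k ∨ i = k + 1) ∧ φ v = pathVertex H (fun _ => 6) e i := by
      rcases hvf with h | h
      exacts [⟨_, Or.inl rfl, h⟩, ⟨_, Or.inr rfl, h⟩]
    obtain ⟨i', hi', hvi'⟩ : ∃ i : ℕ, (i = k' ∨ i = k' + 1) ∧
        φ v = pathVertex H (fun _ => 6) e' i := by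
      rcases hvf' with h | h
      exacts [⟨_, Or.inl rfl, h⟩, ⟨_, Or.inr rfl, h⟩]
    have same : ∀ {k k' : Fin 6} {i : ℕ}, isoEdge φ (e, k) ∈ M → isoEdge φ (e, k') ∈ M →
        (e, k) ≠ (e, k') → (i = k ∨ i = k + 1) → (i = k' ∨ i = k' + 1) → False := by
      intro k k' i hk hk' hne h h'
      have hne' : (k : ℕ) ≠ k' := fun h0 => hne (by rw [Fin.ext h0])
      have h1 := hpath e k (by simpa using hk) k' (by simpa using hk')
      have h2 := hpath e k' (by simpa using hk') k (by simpa using hk)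
      omega
    have hne' : (e, k) ≠ (e', k') := fun h0 => hne (by rw [h0])
    rcases eq_of_pathVertex_eq (by omega) (by omega) (hvi.symm.trans hvi') with
      ⟨rfl, rfl⟩ | ⟨s, s', hs, hs', heq⟩
    · exact same hf hf' hne' hi hi'
    · by_cases hee : e = e'
      · subst hee
        obtain rfl := edgeEnd_injective e heq
        exact same hf hf' hne' hi (by rw [hs, ← hs']; exact hi')
      · refine hend e e' hee s s' ((hends e s).2 ?_) ((hends e' s').2 ?_) heq
        · convert hf
          apply Fin.ext
          cases s <;> simp_all; omega
        · convert hf'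
          apply Fin.ext
          cases s' <;> simp_all; omega

open Classical in
/-- The weighted count of the matchings of the subdivision, path by path. -/
theorem sum_matchings_subdivision [Fintype V] [Fintype W] {R : Type} [CommRing R] (a b : Fin 6 → R)
    (φ : G ≃g subdivision H fun _ => 6) :
    (∑ M ∈ matchings G, ∏ f, if f ∈ M then a ((isoEdge φ).symm f).2 else b ((isoEdge φ).symm f).2) =
      ∑ σ : H.edgeSet → Bool × Bool with EndsIndep σ, ∏ e, gadgetWeight a b (σ e) := by
  rw [← sum_prod_pathWeight]
  refine Finset.sum_bij' (fun M _ e => Finset.univ.filter fun k => isoEdge φ (e, k) ∈ M)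
    (fun S _ => Finset.univ.filter fun f => ((isoEdge φ).symm f).2 ∈ S ((isoEdge φ).symm f).1)
    ?_ ?_ ?_ ?_ ?_
  · intro M hM
    rw [matchings, Finset.mem_filter] at hM
    exact Finset.mem_filter.2 ⟨Finset.mem_univ _, (isMatching_iff_path φ M).1 hM.2⟩
  · intro S hS
    simpa [matchings, isMatching_iff_path φ] using hS
  · intro M _
    ext f
    simp
  · intro S _
    funext e
    ext k
    simp
  · intro M _
    rw [← (isoEdge φ).prod_comp, Fintype.prod_prod_type]
    simp [pathWeight]

end Subdivision

/-! ### The probability of a matching modulo `2 ^ (m + 3) + 3` -/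

/-- The numerators of the probabilities of the edges of a path. -/
def pathNum : Fin 6 → ℕ := ![3, 3, 9, 3, 27, 3]

/-- The binary logarithms of the denominators of the probabilities of the edges of a path. -/
def pathExp (m : ℕ) : Fin 6 → ℕ := ![m + 3, 2, 2 * m + 5, m + 3, 2 * m + 6, 2 * m + 4]

/-- The probabilities of the edges of a path. -/
def pathProb (m : ℕ) (k : Fin 6) : ℚ := pathNum k / 2 ^ pathExp m k

theorem pathNum_le (m : ℕ) (k : Fin 6) : pathNum k ≤ 2 ^ pathExp m k := by
  have h : 1 ≤ 2 ^ m := Nat.one_le_two_pow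
  have h2 : 1 ≤ 2 ^ (2 * m) := Nat.one_le_two_pow
  fin_cases k <;> simp [pathNum, pathExp, pow_add] <;> omega

theorem pathProb_nonneg (m : ℕ) (k : Fin 6) : 0 ≤ pathProb m k := by
  unfold pathProb; positivity

theorem pathProb_le_one (m : ℕ) (k : Fin 6) : pathProb m k ≤ 1 := by
  unfold pathProb
  rw [div_le_one (by positivity)]
  exact_mod_cast pathNum_le m k

theorem sum_pathExp (m : ℕ) : ∑ k, pathExp m k = 8 * m + 23 := by
  simp [Fin.sum_univ_six, pathExp]; ring

/-- Where `2 ^ (m + 3) = -3`, the probabilities of the edges of a path are `-1`, `3 / 4`, `2`,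
`-1`, `3` and `4 / 3`, and the path behaves like a single edge. -/
theorem gadgetWeight_path {R : Type} [CommRing R] {m : ℕ} (h : (2 : R) ^ (m + 3) + 3 = 0) :
    let a : Fin 6 → R := fun k => pathNum k
    let b : Fin 6 → R := fun k => 2 ^ pathExp m k - pathNum k
    gadgetWeight a b (false, false) = 2 * 2 ^ (8 * m + 23) ∧
    gadgetWeight a b (true, false) = 0 ∧ gadgetWeight a b (false, true) = 0 ∧
    gadgetWeight a b (true, true) = 2 * 2 ^ (8 * m + 23) := by
  intro a b
  obtain ⟨u, hu⟩ : ∃ u : R, u = 2 ^ m := ⟨_, rfl⟩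
  have h' : 8 * u + 3 = 0 := by rw [hu, ← h, pow_add]; ring
  have hP : (2 : R) ^ (8 * m + 23) = 8388608 * u ^ 8 := by rw [hu, pow_add, pow_mul']; ring
  have hb0 : b 0 = 8 * u - 3 := by simp [b, hu, pathExp, pathNum, pow_add]; ring
  have hb1 : b 1 = 1 := by simp [b, pathExp, pathNum]; norm_num
  have hb2 : b 2 = 32 * u ^ 2 - 9 := by simp [b, hu, pathExp, pathNum, pow_add, pow_mul']; ring
  have hb3 : b 3 = 8 * u - 3 := by simp [b, hu, pathExp, pathNum, pow_add]; ring
  have hb4 : b 4 = 64 * u ^ 2 - 27 := by simp [b, hu, pathExp, pathNum, pow_add, pow_mul']; ring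
  have hb5 : b 5 = 16 * u ^ 2 - 3 := by simp [b, hu, pathExp, pathNum, pow_add, pow_mul']; ring
  have ha0 : a 0 = 3 := by simp [a, pathNum]
  have ha1 : a 1 = 3 := by simp [a, pathNum]
  have ha2 : a 2 = 9 := by simp [a, pathNum]
  have ha3 : a 3 = 3 := by simp [a, pathNum]
  have ha4 : a 4 = 27 := by simp [a, pathNum]
  have ha5 : a 5 = 3 := by simp [a, pathNum]
  obtain ⟨e1, e2, e3, e4⟩ := gadgetWeight_eq a b
  rw [e1, e2, e3, e4, hb0, hb1, hb2, hb3, hb4, hb5, ha0, ha1, ha2, ha3, ha4, ha5, hP]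
  -- the cofactors are the quotients of the polynomials in `u` by `8 * u + 3`
  refine ⟨?_, ?_, ?_, ?_⟩
  · linear_combination (8748 - 46656 * u + 41472 * u ^ 2 + 69120 * u ^ 3 + 119808 * u ^ 4 -
      417792 * u ^ 5 - 1048576 * u ^ 7) * h'
  · linear_combination (-2187 + 5832 * u + 9072 * u ^ 2 - 24192 * u ^ 3 - 4608 * u ^ 4 -
      36864 * u ^ 5 + 98304 * u ^ 6) * h'
  · linear_combination (-2187 - 5832 * u + 67392 * u ^ 2 - 69120 * u ^ 3 - 147456 * u ^ 4 +
      196608 * u ^ 5) * h'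
  · linear_combination (2187 - 5832 * u + 10368 * u ^ 2 - 48384 * u ^ 3 + 129024 * u ^ 4 -
      294912 * u ^ 5 + 786432 * u ^ 6 - 2097152 * u ^ 7) * h'

section Probability

variable {W : Type} [Fintype W] {G : SimpleGraph W}

open Classical in
theorem edgeSetProb_eq_prod (π : G.edgeSet → ℚ) (M : Finset G.edgeSet) :
    edgeSetProb π M = ∏ f, if f ∈ M then π f else 1 - π f := by
  rw [Finset.prod_ite, edgeSetProb]
  congr 1
  · exact Finset.prod_congr (by ext; simp) fun _ _ => rfl
  · exact Finset.prod_congr (by ext; simp) fun _ _ => rfl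

theorem edgeSetProb_nonneg {π : G.edgeSet → ℚ} (h0 : ∀ f, 0 ≤ π f) (h1 : ∀ f, π f ≤ 1)
    (M : Finset G.edgeSet) : 0 ≤ edgeSetProb π M :=
  mul_nonneg (Finset.prod_nonneg fun f _ => h0 f)
    (Finset.prod_nonneg fun f _ => sub_nonneg.2 (h1 f))

theorem matchingProb_nonneg {π : G.edgeSet → ℚ} (h0 : ∀ f, 0 ≤ π f) (h1 : ∀ f, π f ≤ 1) :
    0 ≤ matchingProb π :=
  Finset.sum_nonneg fun M _ => edgeSetProb_nonneg h0 h1 M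

theorem matchingProb_le_one {π : G.edgeSet → ℚ} (h0 : ∀ f, 0 ≤ π f) (h1 : ∀ f, π f ≤ 1) :
    matchingProb π ≤ 1 := by
  classical
  calc matchingProb π ≤ ∑ M : Finset G.edgeSet, edgeSetProb π M :=
        Finset.sum_le_sum_of_subset_of_nonneg (Finset.subset_univ _)
          fun M _ _ => edgeSetProb_nonneg h0 h1 M
    _ = ∏ f : G.edgeSet, (π f + (1 - π f)) := by
        rw [Finset.prod_add, Finset.powerset_univ]
        refine Finset.sum_congr rfl fun M _ => ?_
        rw [edgeSetProb, ← Finset.compl_eq_univ_sdiff]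
    _ = 1 := by simp

variable {V : Type} [LinearOrder V] [Fintype V] {H : SimpleGraph V}

open Classical in
/-- The probability of a matching on the subdivision of a graph with `m` edges determines the number
of matchings of this graph modulo `2 ^ (m + 3) + 3`. -/
theorem matchingProb_subdivision (φ : G ≃g subdivision H fun _ => 6) {π : G.edgeSet → ℚ} {m : ℕ}
    (hm : m = Fintype.card H.edgeSet)
    (hπ : ∀ f, π f = pathProb m ((isoEdge φ).symm f).2) :
    ∃ s ≤ m * (8 * m + 23), (matchingProb π).den = 2 ^ s ∧
      (matchingProb π).num.natAbs ≤ 2 ^ s ∧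
      (matchingProb π).num.natAbs ≡ 2 ^ (s + m) * (matchings H).card [MOD 2 ^ (m + 3) + 3] := by
  have h0 : ∀ f, 0 ≤ π f := fun f => hπ f ▸ pathProb_nonneg m _
  have h1 : ∀ f, π f ≤ 1 := fun f => hπ f ▸ pathProb_le_one m _
  set q := matchingProb π with hq
  -- the common denominator of all probabilities of edge sets is `2 ^ L`
  let a : Fin 6 → ℤ := fun k => pathNum k
  let b : Fin 6 → ℤ := fun k => 2 ^ pathExp m k - pathNum k
  let L := m * (8 * m + 23)
  let Z : ℤ := ∑ M ∈ matchings G,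
    ∏ f, if f ∈ M then a ((isoEdge φ).symm f).2 else b ((isoEdge φ).symm f).2
  have hL : ∏ f : G.edgeSet, (2 : ℚ) ^ pathExp m ((isoEdge φ).symm f).2 = 2 ^ L := by
    rw [← (isoEdge φ).prod_comp, Fintype.prod_prod_type]
    simp only [Equiv.symm_apply_apply, Finset.prod_pow_eq_pow_sum, sum_pathExp]
    rw [Finset.sum_const, Finset.card_univ, ← hm, smul_eq_mul]
  have hqZ : q * 2 ^ L = Z := by
    rw [hq, matchingProb, Finset.sum_mul, Int.cast_sum]
    refine Finset.sum_congr rfl fun M _ => ?_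
    rw [edgeSetProb_eq_prod, ← hL, ← Finset.prod_mul_distrib, Int.cast_prod]
    refine Finset.prod_congr rfl fun f _ => ?_
    rw [hπ, pathProb]
    split_ifs
    · simp [a]
    · simp only [b, Int.cast_sub, Int.cast_pow, Int.cast_ofNat, Int.cast_natCast]
      field_simp
  have hqdiv : q = Rat.divInt Z (2 ^ L) := by
    rw [Rat.divInt_eq_div, ← hqZ]
    push_cast
    field_simp
  have hden : q.den ∣ 2 ^ L := by
    have := Rat.den_dvd Z (2 ^ L)
    rw [← hqdiv] at this
    exact_mod_cast this
  obtain ⟨s, hs, hds⟩ := (Nat.dvd_prime_pow Nat.prime_two).1 hden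
  have hnum0 : 0 ≤ q.num := Rat.num_nonneg.2 (matchingProb_nonneg h0 h1)
  have hnumcast : ((q.num.natAbs : ℕ) : ℤ) = q.num := Int.natAbs_of_nonneg hnum0
  refine ⟨s, hs, hds, ?_, ?_⟩
  · have h := matchingProb_le_one h0 h1
    rw [← hq, Rat.le_iff] at h
    simp only [Rat.den_ofNat, Rat.num_ofNat, Nat.cast_one, mul_one, one_mul, hds] at h
    rw [← hnumcast] at h
    exact_mod_cast h
  · set N := 2 ^ (m + 3) + 3 with hN
    have hcop : Nat.Coprime (2 ^ L) N := by
      refine Nat.Coprime.pow_left L ?_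
      rw [Nat.coprime_two_left, hN, pow_succ]
      exact ⟨2 ^ (m + 2) + 1, by ring⟩
    have hrel : (2 : ZMod N) ^ (m + 3) + 3 = 0 := by
      have := ZMod.natCast_self N
      rw [hN] at this ⊢
      push_cast at this
      exact this
    obtain ⟨g1, g2, g3, g4⟩ := gadgetWeight_path hrel
    have hZ : (Z : ZMod N) = 2 ^ m * 2 ^ L * (matchings H).card := by
      have e := (sum_matchings_subdivision _ _ φ).trans (sum_endsIndep_eq g1 g2 g3 g4)
      rw [← hm, mul_pow, ← pow_mul, mul_comm (8 * m + 23)] at e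
      rw [← e, Int.cast_sum]
      refine Finset.sum_congr rfl fun M _ => ?_
      rw [Int.cast_prod]
      refine Finset.prod_congr rfl fun f _ => ?_
      split_ifs <;> simp [a, b]
    have hint : (q.num : ℤ) * 2 ^ L = Z * 2 ^ s := by
      have h2 : (q.num : ℚ) = q * 2 ^ s := by
        have := Rat.mul_den_eq_num q
        rw [hds] at this
        push_cast at this
        exact this.symm
      have h3 : (q.num : ℚ) * 2 ^ L = Z * 2 ^ s := by rw [h2, ← hqZ]; ring
      exact_mod_cast h3
    rw [← hnumcast] at hint
    generalize q.num.natAbs = x at hint ⊢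
    have hmod : ((x * 2 ^ L : ℕ) : ZMod N) =
        ((2 ^ (s + m) * (matchings H).card * 2 ^ L : ℕ) : ZMod N) := by
      have := congrArg (Int.cast : ℤ → ZMod N) hint
      push_cast at this ⊢
      rw [this, hZ]
      ring
    exact Nat.ModEq.cancel_right_of_coprime (Nat.Coprime.gcd_eq_one hcop.symm)
      ((ZMod.natCast_eq_natCast_iff _ _ _).1 hmod)

end Probability

/-! ### Correctness of the decoding -/

theorem trim_append_true (l : List Bool) : trim (l ++ [true]) = l ++ [true] := by
  induction l with
  | nil => rfl
  | cons b l ih =>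
    have h : trim (b :: (l ++ [true])) =
        if !b && (trim (l ++ [true])).isEmpty then [] else b :: trim (l ++ [true]) := rfl
    rw [List.cons_append, h, ih]
    cases l <;> simp

theorem powTwoBits_eq {β : Type} (k : ℕ) (l : List β) :
    powTwoBits k l = (2 ^ (k + l.length)).bits := by
  have h1 : trim (powTwoBits k l) = powTwoBits k l := by
    rw [powTwoBits, ← List.append_assoc, trim_append_true]
  rw [← h1, trim_eq_bits]
  congr 1
  simp [powTwoBits, bitsVal_append, bitsVal, pow_add]

/-- The sign, numerator and denominator of a rational number. -/
def ratCode (q : ℚ) : RatCode := ((decide (q.num < 0), q.num.natAbs.bits), q.den.bits)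

theorem encRat_eq (q : ℚ) : encRat q = enc (ratCode q) := rfl

open Classical in
theorem card_matchings_pos {V : Type} [Fintype V] (H : SimpleGraph V) : 0 < (matchings H).card :=
  Finset.card_pos.2 ⟨∅, Finset.mem_filter.2 ⟨Finset.mem_univ _, fun e he => by simp at he⟩⟩

open Classical in
theorem card_matchings_le {V : Type} [Fintype V] (H : SimpleGraph V) :
    (matchings H).card ≤ 2 ^ Fintype.card H.edgeSet := by
  rw [← Fintype.card_finset]
  exact Finset.card_le_univ _

theorem bitsVal_modulusBits {β : Type} (E : List β) :
    bitsVal (modulusBits E) = 2 ^ (E.length + 3) + 3 := by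
  simp [modulusBits, bitsVal_cons, bitsVal_append, bitsVal]
  ring

/-- Halving the numerator often enough modulo `2 ^ (m + 3) + 3` yields the number `c`, which is
positive and smaller than the modulus. -/
theorem decodeAnswer_eq {β : Type} (E : List β) {q : ℚ} {s c : ℕ} (hden : q.den = 2 ^ s)
    (hle : q.num.natAbs ≤ 2 ^ s)
    (hmod : q.num.natAbs ≡ 2 ^ (s + E.length) * c [MOD 2 ^ (E.length + 3) + 3])
    (hc : 0 < c) (hc' : c ≤ 2 ^ E.length) : decodeAnswer E (ratCode q) = c.bits := by
  rw [decodeAnswer, trim_eq_bits]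
  congr 1
  have hodd : bitsVal (modulusBits E) % 2 = 1 := by
    rw [bitsVal_modulusBits, pow_succ]
    omega
  have hlen : ((ratCode q).2.tail ++ E.map fun _ => false).length = s + E.length := by
    have h : (ratCode q).2 = powTwoBits s ([] : List Bool) := by
      rw [powTwoBits_eq, ratCode, hden]
      rfl
    rw [h]
    simp [powTwoBits]
  have hnum : bitsVal (ratCode q).1.2 = q.num.natAbs := bitsVal_bits _
  obtain ⟨h1, h2⟩ := halveModIter_spec hodd ((ratCode q).2.tail ++ E.map fun _ => false)
    (ratCode q).1.2
  rw [hlen, hnum] at h1 h2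
  rw [bitsVal_modulusBits] at h1 h2 hodd
  generalize bitsVal (halveModIter (modulusBits E)
    ((ratCode q).2.tail ++ E.map fun _ => false) (ratCode q).1.2) = x at *
  have hcM : c < 2 ^ (E.length + 3) + 3 := by rw [pow_succ, pow_succ, pow_succ]; omega
  have hxM : x ≤ 2 ^ (E.length + 3) + 3 := by
    have hp : 2 ^ s ≤ 2 ^ (s + E.length) := Nat.pow_le_pow_right (by omega) (by omega)
    by_contra! hlt
    have h3 := Nat.mul_le_mul_left (2 ^ (s + E.length)) (Nat.succ_le_of_lt hlt)
    rw [Nat.succ_eq_add_one, Nat.mul_add] at h3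
    omega
  have hcop : Nat.Coprime (2 ^ (s + E.length)) (2 ^ (E.length + 3) + 3) :=
    Nat.Coprime.pow_left _ (by rw [Nat.coprime_two_left, Nat.odd_iff]; exact hodd)
  have hxc : x ≡ c [MOD 2 ^ (E.length + 3) + 3] :=
    Nat.ModEq.cancel_left_of_coprime (Nat.Coprime.gcd_eq_one hcop.symm) (h1.trans hmod)
  rcases hxM.lt_or_eq with hx | rfl
  · exact hxc.eq_of_lt_of_lt hx hcM
  · have h3 : c % (2 ^ (E.length + 3) + 3) = 0 := by
      rw [← hxc, Nat.mod_self]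
    rw [Nat.mod_eq_of_lt hcM] at h3
    omega

theorem sz_ratCode_le {q : ℚ} {s : ℕ} (hden : q.den = 2 ^ s) (hle : q.num.natAbs ≤ 2 ^ s) :
    sz (ratCode q) ≤ 8 * s + 16 := by
  have hbits : ∀ n ≤ 2 ^ s, n.bits.length ≤ s + 1 := by
    intro n hn
    rw [Nat.size_eq_bits_len, Nat.size_le, pow_succ]
    have : 0 < 2 ^ s := by positivity
    omega
  have h1 := sz_bits_le q.num.natAbs.bits
  have h2 := sz_bits_le q.den.bits
  have h3 := hbits _ hle
  have h4 := hbits _ hden.le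
  have h5 := sz_bool_le (decide (q.num < 0))
  simp only [ratCode, sz_prod]
  omega

/-- A fraction with odd numerator and a power of two as denominator is reduced. -/
theorem ratCode_div_pow {a e : ℕ} (ha : a % 2 = 1) (l l' : List Bool) (hl : trim l = l)
    (hla : bitsVal l = a) (hl' : l' = (2 ^ e).bits) :
    ratCode ((a : ℚ) / 2 ^ e) = ((false, l), l') := by
  have hcop : Nat.Coprime ((a : ℤ).natAbs) ((2 ^ e : ℤ).natAbs) := by
    rw [Int.natAbs_natCast, Int.natAbs_pow]
    refine Nat.Coprime.pow_right _ ?_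
    change Nat.Coprime a 2
    rw [Nat.coprime_two_right, Nat.odd_iff]
    exact ha
  have hnum := Rat.num_div_eq_of_coprime (by positivity) hcop
  have hden := Rat.den_div_eq_of_coprime (by positivity) hcop
  push_cast at hnum hden
  have hden' : ((a : ℚ) / 2 ^ e).den = 2 ^ e := by exact_mod_cast hden
  rw [ratCode, hnum, hden', hl', ← hl, trim_eq_bits, hla]
  simp

theorem probCodes_eq {β : Type} (E : List β) :
    probCodes E = List.ofFn fun k => ratCode (pathProb E.length k) := by
  have e0 : ratCode (pathProb E.length 0) = ((false, [true, true]), powTwoBits 3 E) :=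
    ratCode_div_pow (by simp [pathNum]) _ _ rfl rfl (by rw [powTwoBits_eq, add_comm]; rfl)
  have e1 : ratCode (pathProb E.length 1) = ((false, [true, true]), [false, false, true]) :=
    ratCode_div_pow (by simp [pathNum]) _ _ rfl rfl (powTwoBits_eq 2 ([] : List Bool))
  have e2 : ratCode (pathProb E.length 2) =
      ((false, [true, false, false, true]), powTwoBits 5 (E ++ E)) :=
    ratCode_div_pow (by simp [pathNum]) _ _ rfl rfl
      (by rw [powTwoBits_eq, List.length_append, ← two_mul, add_comm]; rfl)
  have e3 : ratCode (pathProb E.length 3) = ((false, [true, true]), powTwoBits 3 E) :=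
    ratCode_div_pow (by simp [pathNum]) _ _ rfl rfl (by rw [powTwoBits_eq, add_comm]; rfl)
  have e4 : ratCode (pathProb E.length 4) =
      ((false, [true, true, false, true, true]), powTwoBits 6 (E ++ E)) :=
    ratCode_div_pow (by simp [pathNum]) _ _ rfl rfl
      (by rw [powTwoBits_eq, List.length_append, ← two_mul, add_comm]; rfl)
  have e5 : ratCode (pathProb E.length 5) = ((false, [true, true]), powTwoBits 4 (E ++ E)) :=
    ratCode_div_pow (by simp [pathNum]) _ _ rfl rfl
      (by rw [powTwoBits_eq, List.length_append, ← two_mul, add_comm]; rfl)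
  simp [List.ofFn_succ, probCodes, ← e0, ← e1, ← e2, ← e4, ← e5]
  exact e3 ▸ e0 ▸ rfl

/-! ### Correctness of the query -/

open Classical in
/-- The adjacency matrix of a graph as a list of lists. -/
noncomputable def rows (G : FinGraph) : List (List Bool) :=
  List.ofFn fun i => List.ofFn fun j => decide (G.graph.Adj i j)

theorem zipIdx_ofFn {β : Type} {n : ℕ} (f : Fin n → β) :
    (List.ofFn f).zipIdx = (List.finRange n).map fun i => (f i, (i : ℕ)) := by
  apply List.ext_getElem <;> simp

section Query

variable (X : FinGraph)

/-- The name of an edge. -/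
def edgeCode (e : X.graph.edgeSet) : ℕ × ℕ :=
  ((edgeEnd e false : Fin X.n), (edgeEnd e true : Fin X.n))

/-- The name of a vertex of the subdivision. -/
def vertexCode : SubVertex X.graph (fun _ => 6) → VertexCode
  | Sum.inl v => (v, v, 0)
  | Sum.inr ⟨e, k⟩ => ((edgeCode X e).1, (edgeCode X e).2, k + 1)

theorem edge_eq_mk {V : Type} [LinearOrder V] {H : SimpleGraph V} (e : H.edgeSet) :
    (e : Sym2 V) = s(edgeEnd e false, edgeEnd e true) := by
  obtain ⟨e, he⟩ := e
  induction e using Sym2.ind with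
  | _ x y =>
    rcases le_total x y with h | h <;> simp [edgeEnd, h, Sym2.eq_swap]

theorem edgeEnd_lt {V : Type} [LinearOrder V] {H : SimpleGraph V} (e : H.edgeSet) :
    edgeEnd e false < edgeEnd e true :=
  lt_of_le_of_ne (Sym2.inf_le_sup _) fun h => by simpa using edgeEnd_injective e h

theorem edgeCode_injective : Function.Injective (edgeCode X) := by
  intro e e' h
  simp only [edgeCode, Prod.mk.injEq, Fin.val_inj] at h
  exact Subtype.ext (by rw [edge_eq_mk e, edge_eq_mk e', h.1, h.2])

theorem vertexCode_injective : Function.Injective (vertexCode X) := by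
  rintro (v | ⟨e, k⟩) (v' | ⟨e', k'⟩) h
  · simp only [vertexCode, Prod.mk.injEq, Fin.val_inj] at h
    rw [h.1]
  · simp [vertexCode] at h
  · simp [vertexCode] at h
  · simp only [vertexCode, Prod.mk.injEq] at h
    obtain rfl := edgeCode_injective X (Prod.ext h.1 h.2.1)
    obtain rfl : k = k' := Fin.ext (by omega)
    rfl

theorem pathCode_edgeCode (e : X.graph.edgeSet) {k : ℕ} (hk : k ≤ 6) :
    pathCode (edgeCode X e) k = vertexCode X (pathVertex X.graph (fun _ => 6) e k) := by
  have key : k = 0 ∨ k = 6 ∨ (0 < k ∧ k < 6) := by omega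
  rcases key with rfl | rfl | ⟨h0, h6⟩
  · rfl
  · rfl
  · rw [pathVertex_inner e h0 h6, pathCode, if_neg (by simp; omega), if_neg (by simp; omega),
      vertexCode, Nat.sub_add_cancel h0]

open Classical in
theorem edgeList_rows : edgeList (rows X) = (List.finRange X.n).flatMap fun i =>
    ((List.finRange X.n).filter fun j => decide (X.graph.Adj i j ∧ i < j)).map
      fun j : Fin X.n => ((i : ℕ), (j : ℕ)) := by
  rw [edgeList, rows, zipIdx_ofFn, List.flatMap_map]
  congr 1
  funext i
  rw [zipIdx_ofFn, List.filter_map, List.map_map]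
  simp [Function.comp_def]

theorem mem_edgeList {x : ℕ × ℕ} : x ∈ edgeList (rows X) ↔ ∃ e, edgeCode X e = x := by
  classical
  rw [edgeList_rows]
  simp only [List.mem_flatMap, List.mem_finRange, true_and, List.mem_map, List.mem_filter,
    decide_eq_true_eq]
  constructor
  · rintro ⟨i, j, ⟨hadj, hij⟩, rfl⟩
    exact ⟨⟨s(i, j), hadj⟩, by simp [edgeCode, edgeEnd, hij.le]⟩
  · rintro ⟨e, rfl⟩
    refine ⟨edgeEnd e false, edgeEnd e true, ⟨?_, edgeEnd_lt e⟩, rfl⟩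
    have := e.2
    rwa [edge_eq_mk e] at this

theorem nodup_edgeList : (edgeList (rows X)).Nodup := by
  classical
  rw [edgeList_rows, List.nodup_flatMap]
  constructor
  · intro i _
    refine ((List.nodup_finRange _).filter _).map ?_
    intro j j' h
    exact Fin.ext (Prod.ext_iff.1 h).2
  · refine (List.nodup_finRange _).imp ?_
    intro i i' hne x hx hx'
    simp only [List.mem_map] at hx hx'
    obtain ⟨j, _, rfl⟩ := hx
    obtain ⟨j', _, h⟩ := hx'
    exact hne (Fin.ext (Prod.ext_iff.1 h).1.symm)

open Classical in
/-- Every edge is listed exactly once, so the modulus and the number of halvings computed from the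
list are the right ones. -/
theorem length_edgeList : (edgeList (rows X)).length = Fintype.card X.graph.edgeSet := by
  rw [← List.toFinset_card_of_nodup (nodup_edgeList X),
    ← Finset.card_univ, ← Finset.card_image_of_injective Finset.univ (edgeCode_injective X)]
  congr 1
  ext x
  simp [mem_edgeList]

theorem vertexList_rows : vertexList (rows X) =
    (List.finRange X.n).map (fun i : Fin X.n => ((i : ℕ), (i : ℕ), 0)) ++
      (edgeList (rows X)).flatMap fun e => [1, 2, 3, 4, 5].map fun k => (e.1, e.2, k) := by
  rw [vertexList]
  congr 1
  rw [rows, zipIdx_ofFn, List.map_map]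
  rfl

theorem mem_vertexList {x : VertexCode} : x ∈ vertexList (rows X) ↔ ∃ v, vertexCode X v = x := by
  rw [vertexList_rows, List.mem_append, List.mem_flatMap]
  simp only [List.mem_map, List.mem_finRange, true_and, mem_edgeList]
  constructor
  · rintro (⟨i, rfl⟩ | ⟨_, ⟨e, rfl⟩, k, hk, rfl⟩)
    · exact ⟨Sum.inl i, rfl⟩
    · have hk' : 1 ≤ k ∧ k < 6 := by
        simp only [List.mem_cons, List.not_mem_nil, or_false] at hk
        omega
      exact ⟨Sum.inr ⟨e, ⟨k - 1, by change k - 1 < 5; omega⟩⟩, by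
        simp only [vertexCode]
        rw [Nat.sub_add_cancel hk'.1]⟩
  · rintro ⟨v | ⟨e, k, hk⟩, rfl⟩
    · exact Or.inl ⟨v, rfl⟩
    · refine Or.inr ⟨_, ⟨e, rfl⟩, k + 1, ?_, rfl⟩
      change k < 5 at hk
      simp only [List.mem_cons, List.not_mem_nil]
      omega

theorem nodup_vertexList : (vertexList (rows X)).Nodup := by
  rw [vertexList_rows, List.nodup_append]
  refine ⟨(List.nodup_finRange _).map fun i j h => Fin.ext (Prod.ext_iff.1 h).1, ?_, ?_⟩
  · rw [List.nodup_flatMap]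
    constructor
    · intro e _
      refine List.Nodup.map ?_ (by decide)
      intro k k' h
      simpa using h
    · refine (nodup_edgeList X).imp ?_
      intro e e' hne x hx hx'
      simp only [List.mem_map] at hx hx'
      obtain ⟨k, _, rfl⟩ := hx
      obtain ⟨k', _, h⟩ := hx'
      simp only [Prod.mk.injEq] at h
      exact hne (Prod.ext h.1.symm h.2.1.symm)
  · intro x hx y hy hxy
    subst hxy
    simp only [List.mem_map, List.mem_flatMap] at hx hy
    obtain ⟨i, _, rfl⟩ := hx
    obtain ⟨e, _, k, hk, h⟩ := hy
    simp only [Prod.mk.injEq] at h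
    rw [h.2.2] at hk
    simp at hk

/-- The numbering of the vertices of the subdivision by the positions in the list of names. -/
noncomputable def vertexEquiv :
    Fin (vertexList (rows X)).length ≃ SubVertex X.graph (fun _ => 6) :=
  ((nodup_vertexList X).getEquiv _).trans
    (Equiv.ofBijective (fun v => ⟨vertexCode X v, (mem_vertexList X).2 ⟨v, rfl⟩⟩)
      ⟨fun _ _ h => vertexCode_injective X (congrArg Subtype.val h), fun ⟨x, hx⟩ => by
        obtain ⟨v, rfl⟩ := (mem_vertexList X).1 hx
        exact ⟨v, rfl⟩⟩).symm

theorem vertexCode_vertexEquiv (i : Fin (vertexList (rows X)).length) :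
    vertexCode X (vertexEquiv X i) = (vertexList (rows X))[i] := by
  have h := Equiv.ofBijective_apply_symm_apply
    (fun v => (⟨vertexCode X v, (mem_vertexList X).2 ⟨v, rfl⟩⟩ : {x // x ∈ vertexList (rows X)}))
      ⟨fun _ _ h => vertexCode_injective X (congrArg Subtype.val h), fun ⟨x, hx⟩ => by
        obtain ⟨v, rfl⟩ := (mem_vertexList X).1 hx
        exact ⟨v, rfl⟩⟩ ((nodup_vertexList X).getEquiv _ i)
  exact congrArg Subtype.val h

/-- The subdivision with the numbering of its vertices. -/
noncomputable def subGraph : FinGraph where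
  n := (vertexList (rows X)).length
  graph := (subdivision X.graph fun _ => 6).comap (vertexEquiv X)

/-- The numbered subdivision is a subdivision. -/
noncomputable def subIso : (subGraph X).graph ≃g subdivision X.graph fun _ => 6 :=
  SimpleGraph.Iso.comap (vertexEquiv X) _

/-- The query: the subdivision with the probabilities of the edges. -/
noncomputable def query : ProbGraph where
  toFinGraph := subGraph X
  prob f := pathProb (edgeList (rows X)).length ((isoEdge (subIso X)).symm f).2
  prob_nonneg _ := pathProb_nonneg _ _
  prob_le_one _ := pathProb_le_one _ _

theorem mem_weightedEdgeList {w : (VertexCode × VertexCode) × RatCode} :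
    w ∈ weightedEdgeList (edgeList (rows X)) ↔ ∃ (e : X.graph.edgeSet) (k : Fin 6),
      w = ((vertexCode X (pathVertex X.graph (fun _ => 6) e k),
        vertexCode X (pathVertex X.graph (fun _ => 6) e (k + 1))),
        ratCode (pathProb (edgeList (rows X)).length k)) := by
  rw [weightedEdgeList, probCodes_eq, zipIdx_ofFn]
  simp only [List.mem_flatMap, mem_edgeList, List.mem_map, List.mem_finRange, true_and]
  constructor
  · rintro ⟨_, ⟨e, rfl⟩, _, ⟨k, rfl⟩, rfl⟩
    exact ⟨e, k, by rw [pathCode_edgeCode X e (by omega), pathCode_edgeCode X e (by omega)]⟩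
  · rintro ⟨e, k, rfl⟩
    exact ⟨_, ⟨e, rfl⟩, _, ⟨k, rfl⟩, by
      rw [pathCode_edgeCode X e (by omega), pathCode_edgeCode X e (by omega)]⟩

theorem lookupEdge_eq_some {W : List ((VertexCode × VertexCode) × RatCode)} {u v : VertexCode}
    {r : RatCode} (hex : ∃ w ∈ W, s(w.1.1, w.1.2) = s(u, v))
    (hall : ∀ w ∈ W, s(w.1.1, w.1.2) = s(u, v) → w.2 = r) : lookupEdge W u v = some r := by
  rw [lookupEdge]
  rcases h : (W.filter fun w => (w.1.1 == u && w.1.2 == v) || (w.1.1 == v && w.1.2 == u)) with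
    _ | ⟨w, l⟩
  · exfalso
    obtain ⟨w, hw, hwe⟩ := hex
    have := List.filter_eq_nil_iff.1 h w hw
    simp only [Bool.or_eq_true, Bool.and_eq_true, beq_iff_eq] at this
    exact this (Sym2.eq_iff.1 hwe)
  · have hw : w ∈ W.filter fun w => (w.1.1 == u && w.1.2 == v) || (w.1.1 == v && w.1.2 == u) := by
      rw [h]; exact List.mem_cons_self
    rw [List.mem_filter] at hw
    have hwe : s(w.1.1, w.1.2) = s(u, v) := by
      have := hw.2
      simp only [Bool.or_eq_true, Bool.and_eq_true, beq_iff_eq] at this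
      exact Sym2.eq_iff.2 this
    rw [h]
    exact congrArg some (hall w hw.1 hwe)

theorem lookupEdge_eq_none {W : List ((VertexCode × VertexCode) × RatCode)} {u v : VertexCode}
    (hall : ∀ w ∈ W, s(w.1.1, w.1.2) ≠ s(u, v)) : lookupEdge W u v = none := by
  have h : (W.filter fun w => (w.1.1 == u && w.1.2 == v) || (w.1.1 == v && w.1.2 == u)) = [] := by
    rw [List.filter_eq_nil_iff]
    intro w hw
    simp only [Bool.or_eq_true, Bool.and_eq_true, beq_iff_eq]
    exact fun h => hall w hw (Sym2.eq_iff.2 h)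
  rw [lookupEdge, h]
  rfl

theorem vertexCode_eq_iff_isoEdge (e : X.graph.edgeSet) (k : Fin 6)
    (i j : Fin (vertexList (rows X)).length) :
    s(vertexCode X (pathVertex X.graph (fun _ => 6) e k),
      vertexCode X (pathVertex X.graph (fun _ => 6) e (k + 1))) =
      s(vertexCode X (vertexEquiv X i), vertexCode X (vertexEquiv X j)) ↔
    (isoEdge (subIso X) (e, k) : Sym2 (Fin (subGraph X).n)) = s(i, j) := by
  have h : Sym2.map (subIso X) (isoEdge (subIso X) (e, k) : Sym2 (Fin (subGraph X).n)) =
      (subEdge (e, k) : Sym2 _) :=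
    congrArg Subtype.val ((subIso X).mapEdgeSet.apply_symm_apply (subEdge (e, k)))
  refine Iff.trans ?_ (Sym2.map.injective (subIso X).injective).eq_iff
  rw [h]
  exact (Sym2.map.injective (vertexCode_injective X)).eq_iff (a := (subEdge (e, k) : Sym2 _))
    (b := s(vertexEquiv X i, vertexEquiv X j))

theorem map_entry_query (i j : Fin (vertexList (rows X)).length) :
    ((query X).entry i j).map ratCode = lookupEdge (weightedEdgeList (edgeList (rows X)))
      (vertexList (rows X))[i] (vertexList (rows X))[j] := by
  symm
  rw [← vertexCode_vertexEquiv X i, ← vertexCode_vertexEquiv X j]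
  by_cases hadj : (subGraph X).graph.Adj i j
  · have hentry : (query X).entry i j = some ((query X).prob ⟨s(i, j), hadj⟩) := dif_pos hadj
    rw [hentry]
    obtain ⟨⟨e, k⟩, hek⟩ := (isoEdge (subIso X)).surjective ⟨s(i, j), hadj⟩
    refine lookupEdge_eq_some ⟨_, (mem_weightedEdgeList X).2 ⟨e, k, rfl⟩, ?_⟩ ?_
    · exact (vertexCode_eq_iff_isoEdge X e k i j).2 (congrArg Subtype.val hek)
    · intro w hw hwe
      obtain ⟨e', k', rfl⟩ := (mem_weightedEdgeList X).1 hw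
      have h' := (vertexCode_eq_iff_isoEdge X e' k' i j).1 hwe
      have h'' : isoEdge (subIso X) (e', k') = ⟨s(i, j), hadj⟩ := Subtype.ext h'
      change _ = ratCode (pathProb _ ((isoEdge (subIso X)).symm ⟨s(i, j), hadj⟩).2)
      rw [← h'', Equiv.symm_apply_apply]
  · have hentry : (query X).entry i j = none := dif_neg hadj
    rw [hentry]
    refine lookupEdge_eq_none fun w hw hwe => hadj ?_
    obtain ⟨e, k, rfl⟩ := (mem_weightedEdgeList X).1 hw
    have h := (isoEdge (subIso X) (e, k)).2
    rw [(vertexCode_eq_iff_isoEdge X e k i j).1 hwe] at h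
    exact h

/-- The query computed by the program is the encoding of the subdivision with its edge
probabilities. -/
theorem encProbGraph_query : encProbGraph (query X) = enc (queryMatrix (rows X)) := by
  have hmap : ∀ {β γ : Type} (f : γ → Data) (g : β → γ) (l : List β),
      encList (fun b => f (g b)) l = encList f (l.map g) := by
    intro β γ f g l
    induction l with
    | nil => rfl
    | cons b l ih => simp [encList, ih]
  have hopt : encOption encRat = fun o => enc (o.map ratCode) := by
    funext o
    cases o <;> rfl
  have hrow : encList (encOption encRat) = fun l => enc (l.map (Option.map ratCode)) := by
    funext l
    rw [hopt, hmap (enc (α := Option RatCode)) (Option.map ratCode)]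
    rfl
  rw [encProbGraph, encMatrix, hrow, hmap (enc (α := List (Option RatCode))) (List.map (Option.map ratCode))]
  change enc (α := List (List (Option RatCode))) _ =
    enc (α := List (List (Option RatCode))) _
  congr 1
  have hlist : ∀ {γ : Type} (f : VertexCode → γ), (vertexList (rows X)).map f =
      List.ofFn fun i : Fin (vertexList (rows X)).length => f (vertexList (rows X))[i] := by
    intro γ f
    apply List.ext_getElem <;> simp
  rw [queryMatrix, hlist, List.map_ofFn]
  congr 1
  funext i
  simp only [Function.comp_def]
  rw [hlist, List.map_ofFn]
  congr 1
  funext j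
  exact map_entry_query X i j

end Query

/-! ### The reduction -/

theorem polyTimeReduces_subdivision (F : Set FinGraph) :
    PolyTimeReduces (countMatchings F) (prMatching (subdivisionFamily F 6)) := by
  classical
  obtain ⟨Q, p, hQ⟩ := PolyTime.queryMatrix
  obtain ⟨D, r, hD⟩ := PolyTime.decodeAnswer
    (PolyTime.id (α := List (List Bool) × RatCode)).fst.edgeList
    (PolyTime.id (α := List (List Bool) × RatCode)).snd
  obtain ⟨pE, hE⟩ := (PolyTime.edgeList (PolyTime.id (α := List (List Bool)))).exists_size_le
  -- bound for the size of the answer of the oracle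
  let B : Polynomial ℕ := 8 * (pE * (8 * pE + 23)) + 16
  refine ⟨.seq (.pair .id (.seq Q .oracle)) D,
    4 * .X + 2 * p + B + r.comp (.X + B + 1), fun O hO X => ?_⟩
  obtain ⟨X, hX⟩ := X
  have hmem : (query X).toFinGraph ∈ subdivisionFamily F 6 := ⟨X, hX, ⟨subIso X⟩⟩
  have hans : O (enc (queryMatrix (rows X))) = enc (ratCode (matchingProb (query X).prob)) := by
    rw [← encProbGraph_query, ← encRat_eq]
    exact hO ⟨query X, hmem⟩
  have hm := length_edgeList X
  obtain ⟨s, hs, hden, hle, hmod⟩ := matchingProb_subdivision (subIso X)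
    (π := (query X).prob) (m := (edgeList (rows X)).length) (by convert hm) fun f => rfl
  have hdec : decodeAnswer (edgeList (rows X)) (ratCode (matchingProb (query X).prob)) =
      (matchings X.graph).card.bits := by
    refine decodeAnswer_eq _ hden hle hmod (card_matchings_pos _) ?_
    rw [hm]
    convert card_matchings_le X.graph
  have hsize : sz (ratCode (matchingProb (query X).prob)) ≤ B.eval (sz (rows X)) := by
    refine (sz_ratCode_le hden hle).trans ?_
    have h1 := (length_le_sz (edgeList (rows X))).trans (hE (rows X))
    have h2 := Nat.mul_le_mul h1 (Nat.add_le_add_right (Nat.mul_le_mul_left 8 h1) 23)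
    simp only [B, Polynomial.eval_add, Polynomial.eval_mul, Polynomial.eval_ofNat]
    omega
  have hquery := hQ O (rows X)
  have horacle : RunsIn O .oracle (enc (queryMatrix (rows X)))
      (enc (ratCode (matchingProb (query X).prob)))
      ((enc (queryMatrix (rows X))).size + sz (ratCode (matchingProb (query X).prob))) := by
    rw [sz, ← hans]
    exact ⟨_, le_rfl, Eval.oracle _⟩
  have hpair : RunsIn O (.pair .id (.seq Q .oracle)) (enc (rows X))
      (enc (rows X, ratCode (matchingProb (query X).prob))) _ :=
    RunsIn.id.pair (hquery.seq horacle)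
  have hrun := hpair.seq (hD O (rows X, ratCode (matchingProb (query X).prob)))
  simp only [hdec] at hrun
  obtain ⟨t, ht, hev⟩ := hrun
  refine ⟨t, hev, ht.trans ?_⟩
  have h1 := hquery.size_le
  have h2 : r.eval (sz (rows X, ratCode (matchingProb (query X).prob))) ≤
      r.eval (sz (rows X) + B.eval (sz (rows X)) + 1) :=
    polynomial_eval_mono r (Nat.add_le_add_right (Nat.add_le_add_left hsize _) 1)
  have hin : ((countMatchings F).input ⟨X, hX⟩).size = sz (rows X) := rfl
  rw [hin]
  simp only [Polynomial.eval_add, Polynomial.eval_mul, Polynomial.eval_X, Polynomial.eval_ofNat,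
    Polynomial.eval_comp, Polynomial.eval_one] at h2 ⊢
  have h3 : (enc (rows X)).size = sz (rows X) := rfl
  omega

end MatchingReduction

theorem mainTheorem5 (F : Set MatchingReduction.FinGraph) :
    MatchingReduction.PolyTimeReduces
      (MatchingReduction.countMatchings F)
      (MatchingReduction.prMatching (MatchingReduction.subdivisionFamily F 6)) :=
  MatchingReduction.polyTimeReduces_subdivision F
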